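/- **Conventions.** Let $\kappa\in\mathbb R$. Expressions such as $2\pi/\sqrt\kappa$ are read as $\infty$ when $\kappa\le 0$. Let $M_\kappa$ be the complete simply connected Riemannian surface of constant curvature $\kappa$. A *path* is a continuous map from a nonempty compact interval; its length is the supremum of the sums $\sum_i d(c(t_{i-1}),c(t_i))$ over subdivisions of the interval. A *length space* is a metric space (with finite distances) in which, for all $x,y$ and all $\varepsilon>0$, some path of length $<d(x,y)+\varepsilon$ joins $x$ and $y$. A *geodesic* is a distance-preserving map from a nonempty compact interval; a space is *geodesic* if any two of its points are joined by a geodesic. A subset $S$ of a metric space is *convex* if any two points of $S$ are joined by a geodesic of the space and every such geodesic lies in $S$. A *triangle* consists of three geodesics (its edges) joined cyclically end to end; a *comparison triangle* in $M_\kappa$ is a triangle in $M_\kappa$ with the same edge lengths. A triangle $T$ *satisfies $\mathrm{CAT}(\kappa)$* if its perimeter is $<2\pi/\sqrt\kappa$ and any two points $p,q$ on edges of $T$ satisfy $d(p,q)\le d(p',q')$, where $p',q'$ are the corresponding points on the corresponding edges of a comparison triangle in $M_\kappa$. A metric space is $\mathrm{CAT}(\kappa)$ if it is geodesic and every triangle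 in it of perimeter $<2\pi/\sqrt\kappa$ satisfies $\mathrm{CAT}(\kappa)$. Let $\Delta$ be a closed subset of a length space $\hat X$. A map $\pi:\hat Y\to\hat X$ is a *simple branched cover of $\hat X$ over $\Delta$* if $\hat Y$ is a length space, the restriction $\hat Y\setminus\pi^{-1}(\Delta)\to\hat X\setminus\Delta$ is a covering map that preserves distances near each point of $\hat Y\setminus\pi^{-1}(\Delta)$ (empty fibres are allowed), $\pi$ maps $\pi^{-1}(\Delta)$ onto $\Delta$, and $d(y,z)=d(\pi y,\pi z)$ whenever at least one of $y,z\in\hat Y$ lies in $\pi^{-1}(\Delta)$. **Theorem 3.1.** Let $\kappa\in\mathbb R$, let $\Delta$ be a closed convex subset of a $\mathrm{CAT}(\kappa)$ space $\hat X$, and let $\pi:\hat Y\to\hat X$ be a simple branched cover of $\hat X$ over $\Delta$. If $\kappa>0$, assume also that $\operatorname{diam}\hat X<\dfrac{\pi}{2\sqrt\kappa}$ and $\operatorname{diam}\hat Y<\dfrac{2\pi}{3\sqrt\kappa}$. Then: (i) every triangle in $\hat Y$ satisfies $\mathrm{CAT}(\kappa)$; (ii) if $\Delta$ is complete, then $\hat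 Y$ is geodesic and hence $\mathrm{CAT}(\kappa)$. -/

import Mathlib

open Set Topology

/-- `γ`, restricted to the interval `[0, d(x, y)]`, is a geodesic from `x` to `y`, that is, a
distance-preserving map. (The domain of a geodesic is translated so that it begins at `0`; its
length is then necessarily `d(x, y)`.) Only a distance function is needed to say this. -/
structure IsGeodesicFromTo {X : Type*} [Dist X] (γ : ℝ → X) (x y : X) : Prop where
  source : γ 0 = x
  target : γ (dist x y) = y
  dist_eq : ∀ s ∈ Icc 0 (dist x y), ∀ t ∈ Icc 0 (dist x y), dist (γ s) (γ t) = |s - t|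

/-- Any two points are joined by a geodesic. -/
def IsGeodesicSpace (X : Type*) [Dist X] : Prop :=
  ∀ x y : X, ∃ γ : ℝ → X, IsGeodesicFromTo γ x y

/-- Any two points of `S` are joined by a geodesic of the ambient space, and every such geodesic
lies in `S`. -/
def IsGeodesicallyConvex {X : Type*} [Dist X] (S : Set X) : Prop :=
  ∀ x ∈ S, ∀ y ∈ S,
    (∃ γ : ℝ → X, IsGeodesicFromTo γ x y) ∧
      ∀ γ : ℝ → X, IsGeodesicFromTo γ x y → ∀ t ∈ Icc 0 (dist x y), γ t ∈ S

/-- The distance between any two points is finite (automatic here) and is the infimum of the lengths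
of the paths joining them. The length of a path is its total variation. -/
def IsPathLengthSpace (X : Type*) [MetricSpace X] : Prop :=
  ∀ x y : X, ∀ ε : ℝ, 0 < ε →
    ∃ γ : Path x y, eVariationOn (γ : unitInterval → X) univ < ENNReal.ofReal (dist x y + ε)

/-- A triangle of geodesics. The edge `edge i` runs from `vertex (i + 1)` to `vertex (i + 2)`
(subscripts modulo 3), so that `vertex i` is the vertex opposite to `edge i`. -/
structure GeodesicTriangle (X : Type*) [Dist X] where
  vertex : Fin 3 → X
  edge : Fin 3 → ℝ → X
  isGeodesic : ∀ i, IsGeodesicFromTo (edge i) (vertex (i + 1)) (vertex (i + 2))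

/-- The length of the `i`-th edge; the `i`-th edge is parametrized by `[0, edgeLength i]`. -/
def GeodesicTriangle.edgeLength {X : Type*} [Dist X] (T : GeodesicTriangle X) (i : Fin 3) : ℝ :=
  dist (T.vertex (i + 1)) (T.vertex (i + 2))

/-- The sum of the lengths of the three edges. -/
def GeodesicTriangle.perimeter {X : Type*} [Dist X] (T : GeodesicTriangle X) : ℝ :=
  ∑ i, T.edgeLength i

/-- The points of the model surface of constant curvature `κ`, in the linear model
`κ (x² + y²) + z² = 1` (with `z > 0` if `κ ≤ 0`).

* For `κ > 0`, the point `(x, y, z)` stands for the point `(x, y, z / √κ)` of the round sphere of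
  radius `1 / √κ` about the origin of Euclidean 3-space.
* For `κ = 0` one has `z = 1`, and `(x, y, 1)` stands for the point `(x, y)` of the Euclidean plane.
* For `κ < 0`, the point `(x, y, z)` stands for the point `(√(-κ) x, √(-κ) y, z)` of the upper sheet
  `z² - x² - y² = 1`, `z > 0` of the hyperboloid, which is the hyperbolic plane. -/
@[ext]
structure ModelPlane (κ : ℝ) where
  x : ℝ
  y : ℝ
  z : ℝ
  eqn : κ * (x ^ 2 + y ^ 2) + z ^ 2 = 1
  pos : κ ≤ 0 → 0 < z

/-- The bilinear form of the linear model: the Euclidean inner product of unit vectors for `κ > 0`,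
and minus the Lorentzian inner product for `κ < 0`. -/
def ModelPlane.form {κ : ℝ} (p q : ModelPlane κ) : ℝ :=
  κ * (p.x * q.x + p.y * q.y) + p.z * q.z

/-- The distance of the model surface: the angular distance of the unit sphere times `1 / √κ` for
`κ > 0`, the Euclidean distance of the plane for `κ = 0`, and the hyperbolic distance of the
hyperboloid times `1 / √(-κ)` for `κ < 0`. -/
noncomputable instance ModelPlane.instDist (κ : ℝ) : Dist (ModelPlane κ) where
  dist p q :=
    if 0 < κ then Real.arccos (p.form q) / √κ
    else if κ = 0 then √((p.x - q.x) ^ 2 + (p.y - q.y) ^ 2)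
    else Real.arcosh (p.form q) / √(-κ)

/-- `r < c / √κ`, where the right-hand side is read as `∞` if `κ ≤ 0`. -/
def LTDivSqrt (κ r c : ℝ) : Prop := 0 < κ → r < c / √κ

/-- `T'` is a comparison triangle for `T` in the model surface of curvature `κ`: corresponding edges
have the same length. -/
def GeodesicTriangle.IsComparison {X : Type*} [Dist X] {κ : ℝ} (T : GeodesicTriangle X)
    (T' : GeodesicTriangle (ModelPlane κ)) : Prop :=
  ∀ i, T'.edgeLength i = T.edgeLength i

/-- The `CAT(κ)` inequality for a triangle `T`: the perimeter is less than `2π / √κ`, and points on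
the edges of `T` are at most as far apart as the corresponding points on the edges of a comparison
triangle. (Below that perimeter a comparison triangle exists and is unique up to isometry.) -/
def GeodesicTriangle.SatisfiesCAT {X : Type*} [Dist X] (κ : ℝ) (T : GeodesicTriangle X) : Prop :=
  LTDivSqrt κ T.perimeter (2 * Real.pi) ∧
    ∃ T' : GeodesicTriangle (ModelPlane κ), T.IsComparison T' ∧
      ∀ i j : Fin 3, ∀ s ∈ Icc 0 (T.edgeLength i), ∀ t ∈ Icc 0 (T.edgeLength j),
        dist (T.edge i s) (T.edge j t) ≤ dist (T'.edge i s) (T'.edge j t)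

/-- `CAT(κ)` spaces: geodesic spaces in which every triangle of perimeter less than `2π / √κ`
satisfies the `CAT(κ)` inequality. -/
def IsCATSpace (κ : ℝ) (X : Type*) [Dist X] : Prop :=
  IsGeodesicSpace X ∧
    ∀ T : GeodesicTriangle X, LTDivSqrt κ T.perimeter (2 * Real.pi) → T.SatisfiesCAT κ

/-- `π : Y → X` is a simple branched cover of the length space `X` over its closed subset `Δ`:
`Y` is a length space, `π` is a locally isometric covering map over the complement of `Δ`, the part
of `Y` over `Δ` is a copy of `Δ`, and distances to points over `Δ` are computed in `X`. -/
structure IsSimpleBranchedCover {Y X : Type*} [MetricSpace Y] [MetricSpace X] (π : Y → X)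
    (Δ : Set X) : Prop where
  isPathLengthSpace : IsPathLengthSpace Y
  isCoveringMap : IsCoveringMap (Δᶜ.restrictPreimage π)
  locally_isometric : ∀ y, π y ∉ Δ →
    ∃ U ∈ 𝓝 y, ∀ a ∈ U, ∀ b ∈ U, dist (π a) (π b) = dist a b
  surjOn : Δ ⊆ range π
  dist_eq : ∀ y z, π y ∈ Δ ∨ π z ∈ Δ → dist y z = dist (π y) (π z)

/-!
A space has curvature at most `κ` if and only if distances from an apex to the points of a geodesic
are at most those in the model surface. By Stewart's theorem this is an inequality that is linear in
the versines of the distances (`Stewart`, `SatisfiesStewart`), with a versine `gver κ` that makes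
sense for every `κ`. It is equivalent to the `CAT(κ)` inequality for triangles
(`IsCATSpace.satisfiesStewart`, `SatisfiesStewart.satisfiesCAT`). Its two sides, as functions of the
point of the geodesic, are a subsolution and a solution of the same equation `f'' + κ f = const`, so
by the maximum principle it suffices to prove it for the midpoint of one short segment about each
interior point (`stewart_of_forall_midpoint`).

Let `A` be an apex in the branched cover `Y`. Lifting the family of geodesics from the image of `A`
to the points of a nearly shortest path shows that either `A` is joined to a point by a lift of a
geodesic, or nearly shortest paths to the point go through the branch locus `Δ`
(`IsSimpleBranchedCover.exists_geodesic_or`). Hence the distance from `A` is either the distance in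
the base `X`, or the distance in two copies of `X` that are glued along `Δ`
(`IsSimpleBranchedCover.dist_eq_gluedDist`). The latter satisfies Stewart's inequality by
Reshetnyak's gluing theorem (`SatisfiesStewart.stewart_gluedDist`), which comes from Alexandrov's
lemma (`exists_stewart_add`).

Consider a geodesic of `Y` and an interior point of it. If a neighbourhood of the point in the
geodesic projects to a geodesic, the inequality holds for short segments: where the distance from
`A` exceeds that of the base, it is a glued distance in a neighbourhood, and where it does not, the
distance of the base touches it from below (`IsSimpleBranchedCover.exists_stewart_midpoint`). This
applies away from `Δ`, and to all geodesics that start on `Δ`. If the point lies over `Δ`, its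
geodesic to `A` is one of the latter, so the distances from that geodesic to the ends of a short
segment are controlled; since moving the point towards `A` cannot shorten the segment, the first
variation gives the inequality (`stewart_of_first_variation`,
`IsSimpleBranchedCover.stewart_midpoint_of_mem`).

If `Δ` is complete, then a minimizing sequence of points of `Δ` for a glued distance is a Cauchy
sequence, since otherwise the midpoints of its terms would be better
(`SatisfiesStewart.exists_gluedDist_eq`). So the infimum is attained, and points of `Y` that are not
joined by a lift of a geodesic are joined by two geodesics that meet over `Δ`.
-/

/-! ### Trigonometry of the model surfaces -/

/-- The generalized sine: the solution of `f'' + κ f = 0` with `f 0 = 0` and `f' 0 = 1`. -/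
noncomputable def gsin (κ x : ℝ) : ℝ :=
  if 0 < κ then Real.sin (√κ * x) / √κ
  else if κ = 0 then x
  else Real.sinh (√(-κ) * x) / √(-κ)

/-- The generalized cosine: the solution of `f'' + κ f = 0` with `f 0 = 1` and `f' 0 = 0`. -/
noncomputable def gcos (κ x : ℝ) : ℝ :=
  if 0 < κ then Real.cos (√κ * x)
  else if κ = 0 then 1
  else Real.cosh (√(-κ) * x)

/-- The generalized versine, which is `(1 - gcos κ x) / κ` for `κ ≠ 0` and `x ^ 2 / 2` for `κ = 0`.
It is the function of the distance in which the law of cosines is affine for every `κ`. -/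
noncomputable def gver (κ x : ℝ) : ℝ := 2 * gsin κ (x / 2) ^ 2

/-- Rescaling to curvature `1`, `0` or `-1`. -/
theorem curvature_cases {P : ℝ → Prop} (pos : ∀ r, 0 < r → P (r ^ 2)) (zero : P 0)
    (neg : ∀ r, 0 < r → P (-r ^ 2)) (κ : ℝ) : P κ := by
  rcases lt_trichotomy κ 0 with h | rfl | h
  · have := neg (√(-κ)) (Real.sqrt_pos.2 (by linarith))
    rwa [Real.sq_sqrt (by linarith), neg_neg] at this
  · exact zero
  · have := pos (√κ) (Real.sqrt_pos.2 h)
    rwa [Real.sq_sqrt h.le] at this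

theorem gsin_of_pos {r : ℝ} (hr : 0 < r) (x : ℝ) : gsin (r ^ 2) x = Real.sin (r * x) / r := by
  rw [gsin, if_pos (by positivity), Real.sqrt_sq hr.le]

theorem gcos_of_pos {r : ℝ} (hr : 0 < r) (x : ℝ) : gcos (r ^ 2) x = Real.cos (r * x) := by
  rw [gcos, if_pos (by positivity), Real.sqrt_sq hr.le]

theorem gsin_of_neg {r : ℝ} (hr : 0 < r) (x : ℝ) : gsin (-r ^ 2) x = Real.sinh (r * x) / r := by
  have : 0 < r ^ 2 := by positivity
  rw [gsin, if_neg (by linarith), if_neg (by linarith), neg_neg, Real.sqrt_sq hr.le]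

theorem gcos_of_neg {r : ℝ} (hr : 0 < r) (x : ℝ) : gcos (-r ^ 2) x = Real.cosh (r * x) := by
  have : 0 < r ^ 2 := by positivity
  rw [gcos, if_neg (by linarith), if_neg (by linarith), neg_neg, Real.sqrt_sq hr.le]

@[simp] theorem gsin_curv_zero (x : ℝ) : gsin 0 x = x := by simp [gsin]

@[simp] theorem gcos_curv_zero (x : ℝ) : gcos 0 x = 1 := by simp [gcos]

@[simp] theorem gver_curv_zero (x : ℝ) : gver 0 x = x ^ 2 / 2 := by rw [gver, gsin_curv_zero]; ring

@[simp] theorem gsin_zero (κ : ℝ) : gsin κ 0 = 0 := by simp [gsin]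

@[simp] theorem gcos_zero (κ : ℝ) : gcos κ 0 = 1 := by simp [gcos]

@[simp] theorem gver_zero (κ : ℝ) : gver κ 0 = 0 := by simp [gver]

theorem gsin_neg (κ x : ℝ) : gsin κ (-x) = -gsin κ x := by
  unfold gsin; split_ifs <;> simp [neg_div]

theorem gcos_neg (κ x : ℝ) : gcos κ (-x) = gcos κ x := by
  unfold gcos; split_ifs <;> simp

theorem gsin_add (κ x y : ℝ) :
    gsin κ (x + y) = gsin κ x * gcos κ y + gcos κ x * gsin κ y := by
  unfold gsin gcos; split_ifs
  · rw [mul_add, Real.sin_add]; ring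
  · ring
  · rw [mul_add, Real.sinh_add]; ring

theorem gcos_add (κ x y : ℝ) :
    gcos κ (x + y) = gcos κ x * gcos κ y - κ * (gsin κ x * gsin κ y) := by
  induction κ using curvature_cases with
  | pos r hr =>
    simp only [gsin_of_pos hr, gcos_of_pos hr, mul_add, Real.cos_add]; field_simp
  | zero => simp
  | neg r hr =>
    simp only [gsin_of_neg hr, gcos_of_neg hr, mul_add, Real.cosh_add]; field_simp; ring

theorem gsin_sub (κ x y : ℝ) :
    gsin κ (x - y) = gsin κ x * gcos κ y - gcos κ x * gsin κ y := by
  rw [sub_eq_add_neg, gsin_add, gsin_neg, gcos_neg]; ring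

theorem gcos_sub (κ x y : ℝ) :
    gcos κ (x - y) = gcos κ x * gcos κ y + κ * (gsin κ x * gsin κ y) := by
  rw [sub_eq_add_neg, gcos_add, gsin_neg, gcos_neg]; ring

theorem gcos_sq_add (κ x : ℝ) : gcos κ x ^ 2 + κ * gsin κ x ^ 2 = 1 := by
  have := gcos_sub κ x x
  rw [sub_self, gcos_zero] at this
  rw [this]; ring

theorem gsin_eq_half (κ x : ℝ) : gsin κ x = 2 * (gsin κ (x / 2) * gcos κ (x / 2)) := by
  conv_lhs => rw [← add_halves x, gsin_add]
  ring

theorem gcos_eq_gver (κ x : ℝ) : gcos κ x = 1 - κ * gver κ x := by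
  conv_lhs => rw [← add_halves x, gcos_add]
  have := gcos_sq_add κ (x / 2)
  unfold gver; linear_combination this

theorem gver_neg (κ x : ℝ) : gver κ (-x) = gver κ x := by
  simp [gver, neg_div, gsin_neg]

theorem gver_abs (κ x : ℝ) : gver κ |x| = gver κ x := by
  rcases abs_choice x with h | h <;> rw [h]
  exact gver_neg κ x

theorem gver_nonneg (κ x : ℝ) : 0 ≤ gver κ x := by unfold gver; positivity

theorem gver_add (κ x y : ℝ) :
    gver κ (x + y) = gver κ x + gsin κ x * gsin κ y + gcos κ x * gver κ y := by
  have h1 := gcos_sq_add κ (x / 2)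
  have h2 := gcos_sq_add κ (y / 2)
  rw [gsin_eq_half κ x, gsin_eq_half κ y, gcos_eq_gver κ x]
  simp only [gver, add_div, gsin_add]
  linear_combination (2 * gsin κ (y / 2) ^ 2) * h1 + (2 * gsin κ (x / 2) ^ 2) * h2

theorem continuous_gsin (κ : ℝ) : Continuous (gsin κ) := by
  unfold gsin; split_ifs <;> fun_prop

theorem continuous_gcos (κ : ℝ) : Continuous (gcos κ) := by
  unfold gcos; split_ifs <;> fun_prop

theorem continuous_gver (κ : ℝ) : Continuous (gver κ) := by
  have := continuous_gsin κ
  unfold gver; fun_prop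

/-- `LTDivSqrt κ x c` with a weak inequality. -/
def LEDivSqrt (κ x c : ℝ) : Prop := 0 < κ → x ≤ c / √κ

theorem LTDivSqrt.le {κ x c : ℝ} (h : LTDivSqrt κ x c) : LEDivSqrt κ x c := fun hκ => (h hκ).le

theorem LTDivSqrt.mono {κ x y c : ℝ} (h : LTDivSqrt κ y c) (hxy : x ≤ y) : LTDivSqrt κ x c :=
  fun hκ => hxy.trans_lt (h hκ)

theorem LEDivSqrt.mono {κ x y c : ℝ} (h : LEDivSqrt κ y c) (hxy : x ≤ y) : LEDivSqrt κ x c :=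
  fun hκ => hxy.trans (h hκ)

theorem LTDivSqrt.mono_right {κ x c c' : ℝ} (h : LTDivSqrt κ x c) (hc : c ≤ c') :
    LTDivSqrt κ x c' := fun hκ => (h hκ).trans_le (by gcongr)

theorem ltDivSqrt_sq {r : ℝ} (hr : 0 < r) {x c : ℝ} : LTDivSqrt (r ^ 2) x c ↔ r * x < c := by
  rw [LTDivSqrt, Real.sqrt_sq hr.le, lt_div_iff₀ hr, mul_comm x]
  exact ⟨fun h => h (by positivity), fun h _ => h⟩

theorem leDivSqrt_sq {r : ℝ} (hr : 0 < r) {x c : ℝ} : LEDivSqrt (r ^ 2) x c ↔ r * x ≤ c := by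
  rw [LEDivSqrt, Real.sqrt_sq hr.le, le_div_iff₀ hr, mul_comm x]
  exact ⟨fun h => h (by positivity), fun h _ => h⟩

theorem LTDivSqrt.half {κ x c : ℝ} (h : LTDivSqrt κ x c) : LTDivSqrt κ (x / 2) (c / 2) := by
  intro hκ
  have := h hκ
  rw [div_right_comm]; linarith

theorem LEDivSqrt.half {κ x c : ℝ} (h : LEDivSqrt κ x c) : LEDivSqrt κ (x / 2) (c / 2) := by
  intro hκ
  have := h hκ
  rw [div_right_comm]; linarith

theorem gsin_pos {κ x : ℝ} (hx : 0 < x) (h : LTDivSqrt κ x Real.pi) : 0 < gsin κ x := by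
  induction κ using curvature_cases with
  | pos r hr =>
    rw [gsin_of_pos hr]
    exact div_pos (Real.sin_pos_of_pos_of_lt_pi (by positivity) ((ltDivSqrt_sq hr).1 h)) hr
  | zero => simpa
  | neg r hr =>
    rw [gsin_of_neg hr]
    exact div_pos (Real.sinh_pos_iff.2 (by positivity)) hr

theorem gsin_nonneg {κ x : ℝ} (hx : 0 ≤ x) (h : LEDivSqrt κ x Real.pi) : 0 ≤ gsin κ x := by
  induction κ using curvature_cases with
  | pos r hr =>
    rw [gsin_of_pos hr]
    exact div_nonneg (Real.sin_nonneg_of_nonneg_of_le_pi (by positivity) ((leDivSqrt_sq hr).1 h))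
      hr.le
  | zero => simpa
  | neg r hr =>
    rw [gsin_of_neg hr]
    exact div_nonneg (Real.sinh_nonneg_iff.2 (by positivity)) hr.le

theorem gcos_pos {κ x : ℝ} (h : LTDivSqrt κ |x| (Real.pi / 2)) : 0 < gcos κ x := by
  induction κ using curvature_cases with
  | pos r hr =>
    rw [gcos_of_pos hr]
    have h' := (ltDivSqrt_sq hr).1 h
    rw [← abs_of_pos hr, ← abs_mul, abs_lt] at h'
    exact Real.cos_pos_of_mem_Ioo h'
  | zero => simp
  | neg r hr => rw [gcos_of_neg hr]; exact Real.cosh_pos _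

theorem gver_lt_gver {κ x y : ℝ} (hx : 0 ≤ x) (hxy : x < y) (hy : LEDivSqrt κ y Real.pi) :
    gver κ x < gver κ y := by
  have key : gsin κ (x / 2) < gsin κ (y / 2) := by
    have h2 := hy.half
    induction κ using curvature_cases with
    | pos r hr =>
      rw [gsin_of_pos hr, gsin_of_pos hr]
      have := (leDivSqrt_sq hr).1 h2
      have hπ := Real.pi_pos
      have hrx : 0 ≤ r * (x / 2) := by positivity
      exact div_lt_div_of_pos_right (Real.sin_lt_sin_of_lt_of_le_pi_div_two
        (by linarith) this (by gcongr)) hr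
    | zero => simp only [gsin_curv_zero]; linarith
    | neg r hr =>
      rw [gsin_of_neg hr, gsin_of_neg hr]
      exact div_lt_div_of_pos_right (Real.sinh_lt_sinh.2 (by gcongr)) hr
  have h0 : 0 ≤ gsin κ (x / 2) :=
    gsin_nonneg (by linarith) (hy.mono (by linarith))
  unfold gver
  gcongr

theorem gver_le_gver {κ x y : ℝ} (hx : 0 ≤ x) (hxy : x ≤ y) (hy : LEDivSqrt κ y Real.pi) :
    gver κ x ≤ gver κ y := by
  rcases hxy.eq_or_lt with rfl | h
  · rfl
  · exact (gver_lt_gver hx h hy).le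

theorem le_of_gver_le {κ x y : ℝ} (hy : 0 ≤ y) (hx : LEDivSqrt κ x Real.pi)
    (h : gver κ x ≤ gver κ y) : x ≤ y := by
  by_contra! hlt
  exact absurd (gver_lt_gver hy hlt hx) (not_lt.2 h)

theorem gver_pos {κ x : ℝ} (hx : 0 < x) (h : LEDivSqrt κ x Real.pi) : 0 < gver κ x := by
  simpa using gver_lt_gver le_rfl hx h

theorem gver_injective {κ x y : ℝ} (hx0 : 0 ≤ x) (hx : LEDivSqrt κ x Real.pi) (hy0 : 0 ≤ y)
    (hy : LEDivSqrt κ y Real.pi) (h : gver κ x = gver κ y) : x = y :=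
  le_antisymm (le_of_gver_le hy0 hx h.le) (le_of_gver_le hx0 hy h.ge)

/-! ### Stewart's inequality -/

/-- The right-hand side of Stewart's theorem: in the model surface, let `a` and `b` be the distances
of an apex from the two ends of a segment of length `ℓ`. This is `gsin κ ℓ` times the versine of the
distance of the apex from the point of the segment at distance `s` from its first end. -/
noncomputable def stewartBound (κ ℓ s a b : ℝ) : ℝ :=
  gsin κ (ℓ - s) * gver κ a + gsin κ s * gver κ b
    - 4 * gsin κ (s / 2) * gsin κ ((ℓ - s) / 2) * gsin κ (ℓ / 2)

/-- A point at distance `s` from the first end of a segment of length `ℓ` is at distance `d` from an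
apex, which is at distances `a` and `b` from the ends. The inequality says that `d` is at most the
corresponding distance in the model surface. -/
def Stewart (κ ℓ s a b d : ℝ) : Prop := gsin κ ℓ * gver κ d ≤ stewartBound κ ℓ s a b

theorem Stewart.mono {κ ℓ s a b d a' b' d' : ℝ} (h : Stewart κ ℓ s a b d)
    (hs : s ∈ Icc 0 ℓ) (hℓ : LEDivSqrt κ ℓ Real.pi) (hd'0 : 0 ≤ d') (hd' : d' ≤ d)
    (hd : LEDivSqrt κ d Real.pi) (ha0 : 0 ≤ a) (ha : a ≤ a') (ha' : LEDivSqrt κ a' Real.pi)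
    (hb0 : 0 ≤ b) (hb : b ≤ b') (hb' : LEDivSqrt κ b' Real.pi) :
    Stewart κ ℓ s a' b' d' := by
  have h1 := gver_le_gver hd'0 hd' hd
  have h2 := gver_le_gver ha0 ha ha'
  have h3 := gver_le_gver hb0 hb hb'
  have s1 : 0 ≤ gsin κ ℓ := gsin_nonneg (hs.1.trans hs.2) hℓ
  have s2 : 0 ≤ gsin κ s := gsin_nonneg hs.1 (hℓ.mono hs.2)
  have s3 : 0 ≤ gsin κ (ℓ - s) := gsin_nonneg (by linarith [hs.2]) (hℓ.mono (by linarith [hs.1]))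
  unfold Stewart stewartBound at *
  have := mul_le_mul_of_nonneg_left h1 s1
  have := mul_le_mul_of_nonneg_left h2 s3
  have := mul_le_mul_of_nonneg_left h3 s2
  linarith

/-- Multiplied by `κ`, Stewart's bound is the linear interpolation of cosines. -/
theorem gsin_sub_mul_stewartBound (κ ℓ s a b : ℝ) :
    gsin κ ℓ - κ * stewartBound κ ℓ s a b = gsin κ (ℓ - s) * gcos κ a + gsin κ s * gcos κ b := by
  have hℓ : ℓ = s + (ℓ - s) := by ring
  generalize ℓ - s = u at *
  subst hℓ
  have h1 := gcos_sq_add κ (s / 2)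
  have h2 := gcos_sq_add κ (u / 2)
  rw [stewartBound, gsin_eq_half κ (s + u), gsin_eq_half κ s, gsin_eq_half κ u, gcos_eq_gver κ a,
    gcos_eq_gver κ b, add_sub_cancel_left, gsin_eq_half κ u]
  simp only [add_div, gsin_add, gcos_add]
  linear_combination (2 * gsin κ (u / 2) * gcos κ (u / 2)) * h1
    + (2 * gsin κ (s / 2) * gcos κ (s / 2)) * h2

theorem stewart_of_pos_iff {r ℓ s a b d : ℝ} (hr : 0 < r) :
    Stewart (r ^ 2) ℓ s a b d ↔
      Real.sin (r * (ℓ - s)) * Real.cos (r * a) + Real.sin (r * s) * Real.cos (r * b)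
        ≤ Real.sin (r * ℓ) * Real.cos (r * d) := by
  have h1 := gsin_sub_mul_stewartBound (r ^ 2) ℓ s a b
  have h2 := gcos_eq_gver (r ^ 2) d
  simp only [gsin_of_pos hr, gcos_of_pos hr] at h1 h2
  have hr2 : 0 < r ^ 2 := by positivity
  rw [Stewart, ← mul_le_mul_iff_right₀ hr2, gsin_of_pos hr, h2, ← mul_le_mul_iff_right₀ hr]
  field_simp at h1 ⊢
  constructor <;> intro h <;> nlinarith

theorem stewart_of_neg_iff {r ℓ s a b d : ℝ} (hr : 0 < r) :
    Stewart (-r ^ 2) ℓ s a b d ↔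
      Real.sinh (r * ℓ) * Real.cosh (r * d) ≤
      Real.sinh (r * (ℓ - s)) * Real.cosh (r * a) + Real.sinh (r * s) * Real.cosh (r * b) := by
  have h1 := gsin_sub_mul_stewartBound (-r ^ 2) ℓ s a b
  have h2 := gcos_eq_gver (-r ^ 2) d
  simp only [gsin_of_neg hr, gcos_of_neg hr] at h1 h2
  have hr2 : 0 < r ^ 2 := by positivity
  rw [Stewart, ← mul_le_mul_iff_right₀ hr2, gsin_of_neg hr, h2, ← mul_le_mul_iff_right₀ hr]
  field_simp at h1 ⊢
  constructor <;> intro h <;> nlinarith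

theorem stewart_curv_zero_iff {ℓ s a b d : ℝ} :
    Stewart 0 ℓ s a b d ↔ ℓ * d ^ 2 ≤ (ℓ - s) * a ^ 2 + s * b ^ 2 - s * (ℓ - s) * ℓ := by
  simp only [Stewart, stewartBound, gsin_curv_zero, gver_curv_zero]
  constructor <;> intro h <;> nlinarith

/-- Stewart's inequality at a midpoint. -/
theorem stewart_midpoint_iff {κ h a b d : ℝ} (hh : 0 < h) (hκ : LTDivSqrt κ (2 * h) Real.pi) :
    Stewart κ (2 * h) h a b d ↔ 2 * gcos κ h * gver κ d ≤ gver κ a + gver κ b - 2 * gver κ h := by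
  have h0 : 0 < gsin κ h := gsin_pos hh (hκ.mono (by linarith))
  have e1 : gsin κ (2 * h) = gsin κ h * (2 * gcos κ h) := by rw [two_mul, gsin_add]; ring
  have e2 : stewartBound κ (2 * h) h a b = gsin κ h * (gver κ a + gver κ b - 2 * gver κ h) := by
    rw [stewartBound, show 2 * h - h = h by ring, show 2 * h / 2 = h by ring]
    unfold gver; ring
  rw [Stewart, e1, e2, mul_assoc, mul_le_mul_iff_right₀ h0]

/-! ### The maximum principle and the first variation -/

theorem stewartBound_zero (κ ℓ a b : ℝ) : stewartBound κ ℓ 0 a b = gsin κ ℓ * gver κ a := by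
  simp [stewartBound]

theorem stewartBound_self (κ ℓ a b : ℝ) : stewartBound κ ℓ ℓ a b = gsin κ ℓ * gver κ b := by
  simp [stewartBound]

/-- If the apex is the point of the segment itself, its distance in the model is zero. -/
theorem stewartBound_degenerate (κ ℓ s : ℝ) : stewartBound κ ℓ s s (ℓ - s) = 0 := by
  have hℓ : ℓ = s + (ℓ - s) := by ring
  generalize ℓ - s = u at *
  subst hℓ
  rw [stewartBound, add_sub_cancel_left, gsin_eq_half κ u, gsin_eq_half κ s, add_div, gsin_add,
    gver, gver]
  ring

/-- Stewart's bound solves `f'' + κ f = const`, here in the form of a difference equation. -/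
theorem stewartBound_sub_add (κ ℓ t h a b : ℝ) :
    stewartBound κ ℓ (t - h) a b + stewartBound κ ℓ (t + h) a b
      = 2 * gcos κ h * stewartBound κ ℓ t a b + 2 * gsin κ ℓ * gver κ h := by
  have hℓ : ℓ = t + (ℓ - t) := by ring
  generalize hu : ℓ - t = u at *
  have e1 : ℓ - (t - h) = u + h := by linarith
  have e2 : ℓ - (t + h) = u - h := by linarith
  have h1 := gcos_sq_add κ (h / 2)
  rw [stewartBound, stewartBound, stewartBound, e1, e2, hu, hℓ, gsin_eq_half κ (t + u),
    gcos_eq_gver κ h]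
  simp only [add_div, sub_div, gsin_add κ t, gsin_add κ u, gsin_sub κ t, gsin_sub κ u,
    gcos_eq_gver κ h, gsin_add κ (t / 2), gsin_add κ (u / 2), gsin_sub κ (t / 2),
    gsin_sub κ (u / 2), gcos_add]
  simp only [gver]
  linear_combination (-8 * gsin κ (t / 2) * gsin κ (u / 2) * (gsin κ (t / 2) * gcos κ (u / 2) +
    gcos κ (t / 2) * gsin κ (u / 2))) * h1

/-- The maximum principle: Stewart's inequality holds along a whole segment if it holds for
the midpoints of short subsegments. -/
theorem stewart_of_forall_midpoint {κ ℓ : ℝ} (hℓ : LTDivSqrt κ ℓ Real.pi) {f : ℝ → ℝ}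
    (hf : ContinuousOn f (Icc 0 ℓ))
    (hloc : ∀ t ∈ Ioo 0 ℓ, ∃ h, 0 < h ∧ h ≤ t ∧ h ≤ ℓ - t ∧
      Stewart κ (2 * h) h (f (t - h)) (f (t + h)) (f t)) {s : ℝ} (hs : s ∈ Icc 0 ℓ) :
    Stewart κ ℓ s (f 0) (f ℓ) (f s) := by
  set G : ℝ → ℝ := fun t => gsin κ ℓ * gver κ (f t) - stewartBound κ ℓ t (f 0) (f ℓ) with hG
  set ψ : ℝ → ℝ := fun t => gcos κ (t - ℓ / 2) with hψ
  have hψpos : ∀ t ∈ Icc 0 ℓ, 0 < ψ t := by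
    intro t ht
    refine gcos_pos (hℓ.half.mono ?_)
    rw [abs_le]; constructor <;> linarith [ht.1, ht.2]
  have hψadd : ∀ t h, ψ (t - h) + ψ (t + h) = 2 * gcos κ h * ψ t := by
    intro t h
    have e1 : t - h - ℓ / 2 = (t - ℓ / 2) - h := by ring
    have e2 : t + h - ℓ / 2 = (t - ℓ / 2) + h := by ring
    simp only [hψ, e1, e2]
    rw [gcos_add κ (t - ℓ / 2) h, gcos_sub κ (t - ℓ / 2) h]; ring
  have hcs := continuous_gsin κ
  have hcv := continuous_gver κ
  have hcc := continuous_gcos κ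
  have hGc : ContinuousOn (fun t => G t / ψ t) (Icc 0 ℓ) := by
    refine ContinuousOn.div ?_ (by fun_prop) fun t ht => (hψpos t ht).ne'
    refine ContinuousOn.sub (continuousOn_const.mul (hcv.comp_continuousOn hf)) ?_
    unfold stewartBound
    fun_prop
  have hG0 : G 0 = 0 := by simp only [hG, stewartBound_zero, sub_self]
  have hGℓ : G ℓ = 0 := by simp only [hG, stewartBound_self, sub_self]
  have hGmid : ∀ t ∈ Ioo 0 ℓ, ∃ h, 0 < h ∧ h ≤ t ∧ h ≤ ℓ - t ∧
      2 * gcos κ h * G t ≤ G (t - h) + G (t + h) := by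
    intro t ht
    obtain ⟨h, h0, h1, h2, h3⟩ := hloc t ht
    refine ⟨h, h0, h1, h2, ?_⟩
    rw [stewart_midpoint_iff h0 (hℓ.mono (by linarith))] at h3
    have h4 := stewartBound_sub_add κ ℓ t h (f 0) (f ℓ)
    have h5 : 0 ≤ gsin κ ℓ := gsin_nonneg (hs.1.trans hs.2) hℓ.le
    have h6 := mul_le_mul_of_nonneg_left h3 h5
    simp only [hG]
    linarith
  suffices h : ∀ t ∈ Icc 0 ℓ, G t ≤ 0 by
    have := h s hs
    simp only [hG] at this
    unfold Stewart; linarith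
  by_contra! hcon
  obtain ⟨t₁, ht₁, hpos⟩ := hcon
  obtain ⟨t₂, ht₂, hmax⟩ := isCompact_Icc.exists_isMaxOn ⟨s, hs⟩ hGc
  set m := G t₂ / ψ t₂ with hm
  have hmpos : 0 < m := lt_of_lt_of_le (div_pos hpos (hψpos t₁ ht₁)) (hmax ht₁)
  have hle : ∀ t ∈ Icc 0 ℓ, G t ≤ m * ψ t := fun t ht =>
    (div_le_iff₀ (hψpos t ht)).1 (hmax ht)
  -- the leftmost maximum of the quotient cannot be interior
  have hcomp : IsCompact (Icc 0 ℓ ∩ (fun t => G t / ψ t) ⁻¹' {m}) :=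
    isCompact_Icc.of_isClosed_subset (hGc.preimage_isClosed_of_isClosed isClosed_Icc
      isClosed_singleton) inter_subset_left
  obtain ⟨t, ⟨ht, htm⟩, hleast⟩ := hcomp.exists_isLeast ⟨t₂, ht₂, rfl⟩
  have hGt : G t = m * ψ t := (div_eq_iff (hψpos t ht).ne').1 htm
  have hGtpos : 0 < G t := by rw [hGt]; exact mul_pos hmpos (hψpos t ht)
  have ht0 : t ≠ 0 := by rintro rfl; exact hGtpos.ne' hG0
  have htℓ : t ≠ ℓ := by rintro rfl; exact hGtpos.ne' hGℓ
  obtain ⟨h, h0, h1, h2, h3⟩ := hGmid t ⟨lt_of_le_of_ne ht.1 ht0.symm, lt_of_le_of_ne ht.2 htℓ⟩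
  have hl : t - h ∈ Icc 0 ℓ := ⟨by linarith, by linarith [ht.2]⟩
  have hr : t + h ∈ Icc 0 ℓ := ⟨by linarith [ht.1], by linarith⟩
  have hlt : G (t - h) < m * ψ (t - h) := by
    refine lt_of_le_of_ne (hle _ hl) fun heq => ?_
    have := hleast ⟨hl, (div_eq_iff (hψpos _ hl).ne').2 heq⟩
    linarith
  have := hle _ hr
  have := hψadd t h
  rw [hGt] at h3
  nlinarith

/-- The first variation argument: if the midpoint of a segment of length `2 h` cannot be shortcut by
moving towards an apex at distance `L`, then the distances from the apex satisfy Stewart's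
inequality at the midpoint. -/
theorem stewart_of_first_variation {κ L h a b : ℝ} (hL : 0 < L) (hLκ : LTDivSqrt κ L Real.pi)
    (hh : 0 < h) (hhκ : LTDivSqrt κ (2 * h) Real.pi)
    (H : ∀ τ ∈ Ioo 0 L, ∃ x y, 0 ≤ x ∧ LEDivSqrt κ x Real.pi ∧ 0 ≤ y ∧ LEDivSqrt κ y Real.pi ∧
      2 * h ≤ x + y ∧ Stewart κ L τ h a x ∧ Stewart κ L τ h b y) :
    Stewart κ (2 * h) h a b L := by
  have hLs : 0 < gsin κ L := gsin_pos hL hLκ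
  have key : ∀ τ ∈ Ioo 0 L, 0 ≤ 2 * gver κ h * (-κ * gsin κ (τ / 2) * gsin κ L
      - gcos κ L * gcos κ (τ / 2)) + gcos κ (τ / 2) * (gver κ a + gver κ b)
      - 4 * gsin κ ((L - τ) / 2) * gsin κ (L / 2) := by
    intro τ hτ
    obtain ⟨x, y, hx0, hx, hy0, hy, hxy, h1, h2⟩ := H τ hτ
    have hsum : 2 * gver κ h ≤ gver κ x + gver κ y := by
      -- shrink the two distances so that their sum is `2 h`
      have e1 : gver κ (min x (2 * h)) ≤ gver κ x :=
        gver_le_gver (le_min hx0 (by linarith)) (min_le_left _ _) hx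
      have e2 : gver κ (2 * h - min x (2 * h)) ≤ gver κ y := by
        refine gver_le_gver (by linarith [min_le_right x (2 * h)]) ?_ hy
        rcases min_choice x (2 * h) with e | e <;> rw [e] <;> linarith
      have e3 := gver_add κ h (min x (2 * h) - h)
      have e4 := gver_add κ h (-(min x (2 * h) - h))
      rw [gsin_neg, gver_neg] at e4
      have e5 : 0 < gcos κ h := by
        refine gcos_pos ?_
        rw [abs_of_pos hh]
        convert hhκ.half using 1; ring
      have e6 := mul_nonneg e5.le (gver_nonneg κ (min x (2 * h) - h))
      rw [show h + (min x (2 * h) - h) = min x (2 * h) by ring] at e3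
      rw [show h + -(min x (2 * h) - h) = 2 * h - min x (2 * h) by ring] at e4
      linarith
    have hτs : 0 < gsin κ (τ / 2) :=
      gsin_pos (by linarith [hτ.1]) (hLκ.mono (by linarith [hτ.1, hτ.2]))
    have h3 := mul_le_mul_of_nonneg_left hsum hLs.le
    unfold Stewart stewartBound at h1 h2
    have h4 : 0 ≤ 2 * (gsin κ (L - τ) - gsin κ L) * gver κ h + gsin κ τ * (gver κ a + gver κ b)
        - 8 * gsin κ (τ / 2) * gsin κ ((L - τ) / 2) * gsin κ (L / 2) := by linarith
    have h5 := gcos_eq_gver κ τ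
    rw [gsin_sub, h5, gsin_eq_half κ τ, gver] at h4
    refine (mul_nonneg_iff_of_pos_left (show 0 < 2 * gsin κ (τ / 2) by positivity)).1 ?_
    linarith
  have hcs := continuous_gsin κ
  have hcc := continuous_gcos κ
  have hlim : Filter.Tendsto (fun τ => 2 * gver κ h * (-κ * gsin κ (τ / 2) * gsin κ L
      - gcos κ L * gcos κ (τ / 2)) + gcos κ (τ / 2) * (gver κ a + gver κ b)
      - 4 * gsin κ ((L - τ) / 2) * gsin κ (L / 2)) (𝓝[>] 0) (𝓝 (2 * gver κ h * (-κ * gsin κ (0 / 2)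
      * gsin κ L - gcos κ L * gcos κ (0 / 2)) + gcos κ (0 / 2) * (gver κ a + gver κ b)
      - 4 * gsin κ ((L - 0) / 2) * gsin κ (L / 2))) := by
    refine (Continuous.tendsto ?_ 0).mono_left nhdsWithin_le_nhds
    fun_prop
  have h0 := ge_of_tendsto hlim (Filter.eventually_of_mem (Ioo_mem_nhdsGT hL) key)
  simp only [zero_div, gsin_zero, gcos_zero, sub_zero] at h0
  rw [stewart_midpoint_iff hh hhκ, gcos_eq_gver]
  rw [gcos_eq_gver] at h0
  have e : 4 * gsin κ (L / 2) * gsin κ (L / 2) = 2 * gver κ L := by unfold gver; ring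
  linarith

/-- A point that almost realizes the position of a point of a segment is close to it. -/
theorem tendsto_zero_of_stewart {ι : Type*} {F : Filter ι} {κ ℓ s : ℝ} (hℓ : 0 < ℓ)
    (hκ : LTDivSqrt κ ℓ Real.pi) {a b d : ι → ℝ} (ha : Filter.Tendsto a F (𝓝 s))
    (hb : Filter.Tendsto b F (𝓝 (ℓ - s))) (hd0 : ∀ i, 0 ≤ d i)
    (hd : ∀ i, LEDivSqrt κ (d i) Real.pi) (h : ∀ i, Stewart κ ℓ s (a i) (b i) (d i)) :
    Filter.Tendsto d F (𝓝 0) := by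
  have hs : 0 < gsin κ ℓ := gsin_pos hℓ hκ
  have hcv := continuous_gver κ
  have h1 : Filter.Tendsto (fun i => stewartBound κ ℓ s (a i) (b i) / gsin κ ℓ) F (𝓝 0) := by
    have : Filter.Tendsto (fun i => stewartBound κ ℓ s (a i) (b i)) F
        (𝓝 (stewartBound κ ℓ s s (ℓ - s))) := by
      unfold stewartBound
      exact (((hcv.tendsto _).comp ha).const_mul _ |>.add
        (((hcv.tendsto _).comp hb).const_mul _)).sub_const _
    rw [stewartBound_degenerate] at this
    simpa using this.div_const (gsin κ ℓ)
  rw [Metric.tendsto_nhds]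
  intro ε hε
  by_cases hεκ : LEDivSqrt κ ε Real.pi
  · filter_upwards [h1.eventually_lt_const (gver_pos hε hεκ)] with i hi
    rw [Real.dist_eq, sub_zero, abs_of_nonneg (hd0 i)]
    by_contra! hle
    have e1 := gver_le_gver hε.le hle (hd i)
    have e2 := h i
    rw [Stewart, mul_comm, ← le_div_iff₀ hs] at e2
    linarith
  · refine Filter.Eventually.of_forall fun i => ?_
    rw [Real.dist_eq, sub_zero, abs_of_nonneg (hd0 i)]
    by_contra! hle
    exact hεκ ((hd i).mono hle)

/-! ### Alexandrov's lemma -/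

/-- Division of a side of length `e` in the ratio that makes two sine weights agree. -/
theorem exists_sin_ratio {S : ℝ → ℝ} (hS : Continuous S) (hS0 : S 0 = 0) {e α γ : ℝ} (he : 0 < e)
    (hSe : ∀ x, 0 < x → x ≤ e → 0 < S x) (hα : 0 < α) (hγ : 0 < γ) :
    ∃ y ∈ Ioo 0 e, α * S y = γ * S (e - y) := by
  have hc : ContinuousOn (fun y => γ * S (e - y) - α * S y) (Icc 0 e) := by fun_prop
  have h0 : 0 < γ * S (e - 0) - α * S 0 := by
    rw [hS0]; simp only [sub_zero, mul_zero]; exact mul_pos hγ (hSe e he le_rfl)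
  have h1 : γ * S (e - e) - α * S e < 0 := by
    rw [sub_self, hS0]; simp only [mul_zero, zero_sub, Left.neg_neg_iff]
    exact mul_pos hα (hSe e he le_rfl)
  obtain ⟨y, hy, hy'⟩ := intermediate_value_Ioo' he.le hc ⟨h1, h0⟩
  exact ⟨y, hy, by simp only at hy'; linarith⟩

/-- Alexandrov's lemma on the unit sphere, in the notation of `exists_stewart_add`. If `P` lies on
the great circle arc from `A` to `R`, then, as vectors, `α P = k A + δ R` and `m M = γ Q + δ R`,
where `α = sin t sin (p + r)`, `k = sin t sin r`, `δ = sin t sin p`, `m = sin s sin p` and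
`γ = sin (s - t) sin p`. Hence `α P + γ Q = k A + m M`, and this vector is `N` times the point `x`
of intersection of `P Q` and `A M`. -/
theorem alexandrov_sphere {p q e r s t : ℝ} (hp : 0 < p) (he : 0 < e) (hr : 0 < r) (ht : 0 < t)
    (hts : t < s) (hpr : p + r < Real.pi) (heπ : e < Real.pi) (hsπ : s < Real.pi) :
    ∃ y ∈ Icc 0 e, ∀ a b c f, 0 ≤ a → a ≤ Real.pi → 0 ≤ b → b ≤ Real.pi → 0 ≤ f → f ≤ Real.pi →
      f ≤ a + b →
      Real.sin (e - y) * Real.cos p + Real.sin y * Real.cos q ≤ Real.sin e * Real.cos a →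
      Real.sin (e - y) * Real.cos r + Real.sin y * Real.cos s ≤ Real.sin e * Real.cos c →
      Real.sin (s - t) * Real.cos (e - y) + Real.sin t * Real.cos c ≤ Real.sin s * Real.cos b →
      Real.sin (s - t) * Real.cos q + Real.sin t * Real.cos (p + r)
        ≤ Real.sin s * Real.cos f := by
  have sp : 0 < Real.sin p := Real.sin_pos_of_pos_of_lt_pi hp (by linarith)
  have sr : 0 < Real.sin r := Real.sin_pos_of_pos_of_lt_pi hr (by linarith)
  have spr : 0 < Real.sin (p + r) := Real.sin_pos_of_pos_of_lt_pi (by linarith) hpr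
  have se : 0 < Real.sin e := Real.sin_pos_of_pos_of_lt_pi he heπ
  have ss : 0 < Real.sin s := Real.sin_pos_of_pos_of_lt_pi (by linarith) hsπ
  have st : 0 < Real.sin t := Real.sin_pos_of_pos_of_lt_pi ht (by linarith)
  have sst : 0 < Real.sin (s - t) := Real.sin_pos_of_pos_of_lt_pi (by linarith) (by linarith)
  obtain ⟨y, hy, hratio⟩ := exists_sin_ratio Real.continuous_sin Real.sin_zero he
    (fun x h0 h1 => Real.sin_pos_of_pos_of_lt_pi h0 (by linarith))
    (mul_pos st spr) (mul_pos sst sp)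
  refine ⟨y, ⟨hy.1.le, hy.2.le⟩, fun a b c f ha haπ hb hbπ hf hfπ hfab H1 H2 H3 => ?_⟩
  have sey : 0 < Real.sin (e - y) :=
    Real.sin_pos_of_pos_of_lt_pi (by linarith [hy.2]) (by linarith [hy.1])
  obtain ⟨α, hα⟩ : ∃ α, α = Real.sin t * Real.sin (p + r) := ⟨_, rfl⟩
  obtain ⟨γ, hγ⟩ : ∃ γ, γ = Real.sin (s - t) * Real.sin p := ⟨_, rfl⟩
  obtain ⟨δ, hδ⟩ : ∃ δ, δ = Real.sin t * Real.sin p := ⟨_, rfl⟩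
  obtain ⟨k, hk⟩ : ∃ k, k = Real.sin t * Real.sin r := ⟨_, rfl⟩
  obtain ⟨m, hm⟩ : ∃ m, m = Real.sin s * Real.sin p := ⟨_, rfl⟩
  obtain ⟨N, hN⟩ : ∃ N, N = α * Real.sin e / Real.sin (e - y) := ⟨_, rfl⟩
  rw [← hα, ← hγ] at hratio
  have hαpos : 0 < α := by rw [hα]; positivity
  have hkpos : 0 < k := by rw [hk]; positivity
  have hNpos : 0 < N := by rw [hN]; positivity
  have N1 : N * Real.sin (e - y) = α * Real.sin e := by rw [hN]; field_simp
  have N2 : N * Real.sin y = γ * Real.sin e := by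
    apply mul_right_cancel₀ sey.ne'
    linear_combination Real.sin y * N1 + Real.sin e * hratio
  have N3 : N * Real.cos (e - y) = α * Real.cos e + γ := by
    apply mul_right_cancel₀ se.ne'
    have h1 : Real.sin y = Real.sin e * Real.cos (e - y) - Real.cos e * Real.sin (e - y) := by
      rw [← Real.sin_sub]; congr 1; ring
    rw [h1] at N2
    linear_combination N2 + Real.cos e * N1
  have N4 : N ^ 2 = α ^ 2 + γ ^ 2 + 2 * α * γ * Real.cos e := by
    have h1 := Real.sin_sq_add_cos_sq (e - y)
    have h2 := Real.sin_sq_add_cos_sq e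
    linear_combination (-N ^ 2) * h1 + (N * Real.sin (e - y) + α * Real.sin e) * N1
      + (N * Real.cos (e - y) + α * Real.cos e + γ) * N3 + α ^ 2 * h2
  have m2 : m ^ 2 = γ ^ 2 + δ ^ 2 + 2 * γ * δ * Real.cos s := by
    have h1 := Real.sin_sq_add_cos_sq s
    have h2 := Real.sin_sq_add_cos_sq t
    rw [hm, hγ, hδ, Real.sin_sub]
    linear_combination (Real.sin p * Real.sin t) ^ 2 * h1
      + (-(Real.sin p * Real.sin s) ^ 2) * h2
  have k2 : k ^ 2 = α ^ 2 + δ ^ 2 - 2 * α * δ * Real.cos r := by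
    have h1 := Real.sin_sq_add_cos_sq r
    have h2 := Real.sin_sq_add_cos_sq p
    rw [hk, hα, hδ, Real.sin_add]
    linear_combination (Real.sin t * Real.sin p) ^ 2 * h1
      + (-(Real.sin t * Real.sin r) ^ 2) * h2
  have ak : α * Real.cos p - k = δ * Real.cos (p + r) := by
    have h2 := Real.sin_sq_add_cos_sq p
    rw [hα, hk, hδ, Real.sin_add, Real.cos_add]
    linear_combination Real.sin t * Real.sin r * h2
  have I1 : α * Real.cos p + γ * Real.cos q ≤ N * Real.cos a := by
    refine le_of_mul_le_mul_right ?_ se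
    have := mul_le_mul_of_nonneg_left H1 hNpos.le
    linear_combination this - Real.cos p * N1 - Real.cos q * N2
  have I2 : α * Real.cos r + γ * Real.cos s ≤ N * Real.cos c := by
    refine le_of_mul_le_mul_right ?_ se
    have := mul_le_mul_of_nonneg_left H2 hNpos.le
    linear_combination this - Real.cos r * N1 - Real.cos s * N2
  have I3 : N ^ 2 + m ^ 2 - k ^ 2 ≤ 2 * (N * m * Real.cos b) := by
    have h1 := mul_le_mul_of_nonneg_left H3 (mul_pos hNpos sp).le
    have h2 := mul_le_mul_of_nonneg_left I2 (show 0 ≤ δ by rw [hδ]; positivity)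
    rw [N4, m2, k2]
    have h3 : γ * (α * Real.cos e + γ) + δ * (α * Real.cos r + γ * Real.cos s)
        ≤ N * m * Real.cos b := by
      rw [← N3, hγ, hm]
      rw [hδ] at h2 ⊢
      rw [hγ] at h2
      linarith
    linarith
  -- the square of the length of `k A + m M - N x` for points `A`, `x`, `M` of a great circle
  have key : ∀ a', 0 ≤ a' → a' ≤ a → γ * Real.cos q + δ * Real.cos (p + r)
      ≤ m * Real.cos (a' + b) := by
    intro a' ha0 ha'
    have hmono : Real.cos a ≤ Real.cos a' := Real.cos_le_cos_of_nonneg_of_le_pi ha0 haπ ha'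
    have h1 := mul_le_mul_of_nonneg_left hmono hNpos.le
    have h2 : 0 ≤ k ^ 2 + m ^ 2 + N ^ 2 + 2 * k * m * Real.cos (a' + b)
        - 2 * N * k * Real.cos a' - 2 * N * m * Real.cos b := by
      have e1 := Real.sin_sq_add_cos_sq a'
      have e2 := Real.sin_sq_add_cos_sq b
      rw [Real.cos_add]
      have : k ^ 2 + m ^ 2 + N ^ 2 + 2 * k * m * (Real.cos a' * Real.cos b
          - Real.sin a' * Real.sin b) - 2 * N * k * Real.cos a' - 2 * N * m * Real.cos b
          = (k * Real.cos a' + m * Real.cos b - N) ^ 2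
            + (k * Real.sin a' - m * Real.sin b) ^ 2 := by
        linear_combination (-k ^ 2) * e1 - m ^ 2 * e2
      rw [this]; positivity
    have h3 := mul_le_mul_of_nonneg_left (I1.trans h1) hkpos.le
    refine le_of_mul_le_mul_left ?_ hkpos
    rw [← ak]
    linarith
  have hfin : γ * Real.cos q + δ * Real.cos (p + r) ≤ m * Real.cos f := by
    have hmpos : 0 ≤ m := by rw [hm]; positivity
    rcases le_total (a + b) Real.pi with h | h
    · exact (key a ha le_rfl).trans (mul_le_mul_of_nonneg_left
        (Real.cos_le_cos_of_nonneg_of_le_pi hf h hfab) hmpos)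
    · refine (key (Real.pi - b) (by linarith) (by linarith)).trans
        (mul_le_mul_of_nonneg_left ?_ hmpos)
      rw [sub_add_cancel]
      exact Real.cos_le_cos_of_nonneg_of_le_pi hf le_rfl hfπ
  rw [hγ, hδ, hm] at hfin
  refine le_of_mul_le_mul_right ?_ sp
  linarith

/-- Alexandrov's lemma in the Euclidean plane. The point `x` of intersection of `P Q` and `A M` is
the barycentre of `P` and `Q` with weights `α` and `γ`, and of `A` and `M` with weights `k` and `m`.
-/
theorem alexandrov_plane {p q e r s t : ℝ} (hp : 0 < p) (he : 0 < e) (hr : 0 < r) (ht : 0 < t)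
    (hts : t < s) :
    ∃ y ∈ Icc 0 e, ∀ a b c f, 0 ≤ a → 0 ≤ b → 0 ≤ f → f ≤ a + b →
      e * a ^ 2 ≤ (e - y) * p ^ 2 + y * q ^ 2 - y * (e - y) * e →
      e * c ^ 2 ≤ (e - y) * r ^ 2 + y * s ^ 2 - y * (e - y) * e →
      s * b ^ 2 ≤ (s - t) * (e - y) ^ 2 + t * c ^ 2 - t * (s - t) * s →
      s * f ^ 2 ≤ (s - t) * q ^ 2 + t * (p + r) ^ 2 - t * (s - t) * s := by
  have hst : 0 < s - t := by linarith
  obtain ⟨y, hy, hratio⟩ := exists_sin_ratio continuous_id rfl he (fun x h0 _ => h0)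
    (mul_pos ht (show 0 < p + r by linarith)) (mul_pos hst hp)
  simp only [id] at hratio
  refine ⟨y, ⟨hy.1.le, hy.2.le⟩, fun a b c f ha hb hf hfab H1 H2 H3 => ?_⟩
  obtain ⟨α, hα⟩ : ∃ α, α = t * (p + r) := ⟨_, rfl⟩
  obtain ⟨γ, hγ⟩ : ∃ γ, γ = (s - t) * p := ⟨_, rfl⟩
  obtain ⟨k, hk⟩ : ∃ k, k = t * r := ⟨_, rfl⟩
  obtain ⟨m, hm⟩ : ∃ m, m = s * p := ⟨_, rfl⟩
  rw [← hα, ← hγ] at hratio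
  have hs : 0 < s := by linarith
  have hαpos : 0 < α := by rw [hα]; positivity
  have hγpos : 0 < γ := by rw [hγ]; positivity
  have hkpos : 0 < k := by rw [hk]; positivity
  have hmpos : 0 < m := by rw [hm]; positivity
  have hNpos : 0 < α + γ := by positivity
  have hN : α + γ = k + m := by rw [hα, hγ, hk, hm]; ring
  have hye : (α + γ) * y = γ * e := by linear_combination hratio
  have hey : (α + γ) * (e - y) = α * e := by linear_combination -hratio
  have I1 : (α + γ) * a ^ 2 ≤ α * p ^ 2 + γ * q ^ 2 - γ * (e - y) * e := by
    refine le_of_mul_le_mul_left ?_ he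
    have := mul_le_mul_of_nonneg_left H1 hNpos.le
    linear_combination this + p ^ 2 * hey + q ^ 2 * hye - (e - y) * e * hye
  have I2 : (α + γ) * c ^ 2 ≤ α * r ^ 2 + γ * s ^ 2 - γ * (e - y) * e := by
    refine le_of_mul_le_mul_left ?_ he
    have := mul_le_mul_of_nonneg_left H2 hNpos.le
    linear_combination this + r ^ 2 * hey + s ^ 2 * hye - (e - y) * e * hye
  have I3 : k * m * f ^ 2 ≤ (α + γ) * (k * a ^ 2 + m * b ^ 2) := by
    have h1 : f ^ 2 ≤ (a + b) ^ 2 := pow_le_pow_left₀ hf hfab 2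
    have h2 := mul_le_mul_of_nonneg_left h1 (mul_pos hkpos hmpos).le
    rw [hN]
    nlinarith [sq_nonneg (k * a - m * b)]
  have I4 : (α + γ) * (m * b ^ 2) ≤ p * ((s - t) * ((α + γ) * (e - y) ^ 2)
      + t * (α * r ^ 2 + γ * s ^ 2 - γ * (e - y) * e) - (α + γ) * (t * (s - t) * s)) := by
    have h1 := mul_le_mul_of_nonneg_left H3 (mul_pos hNpos hp).le
    have h2 := mul_le_mul_of_nonneg_left I2 (mul_pos ht hp).le
    rw [hm]
    linarith
  have I5 := mul_le_mul_of_nonneg_left I1 hkpos.le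
  have hkp : 0 < t * r * p := by positivity
  refine le_of_mul_le_mul_left ?_ hkp
  have e1 : (α + γ) * (e - y) ^ 2 = α * e * (e - y) := by linear_combination (e - y) * hey
  rw [e1] at I4
  have e2 : p * t * γ * ((e - y) * e) + k * γ * ((e - y) * e)
      = p * (s - t) * (α * e * (e - y)) := by
    rw [hα, hγ, hk]; ring
  have e3 : t * r * p * (s * f ^ 2) = k * m * f ^ 2 := by rw [hk, hm]; ring
  have e4 : k * (α * p ^ 2 + γ * q ^ 2) + p * (t * (α * r ^ 2 + γ * s ^ 2)
      - (α + γ) * (t * (s - t) * s))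
      = t * r * p * ((s - t) * q ^ 2 + t * (p + r) ^ 2 - t * (s - t) * s) := by
    rw [hα, hγ, hk]; ring
  rw [e3, ← e4]
  linarith

/-- Alexandrov's lemma in the hyperbolic plane, by the computation of `alexandrov_sphere` with
vectors of Minkowski space. -/
theorem alexandrov_hyperbolic {p q e r s t : ℝ} (hp : 0 < p) (he : 0 < e) (hr : 0 < r)
    (ht : 0 < t) (hts : t < s) (hser : s ≤ e + r) :
    ∃ y ∈ Icc 0 e, ∀ a b c f, 0 ≤ a → 0 ≤ b → 0 ≤ f → f ≤ a + b →
      Real.sinh e * Real.cosh a ≤ Real.sinh (e - y) * Real.cosh p + Real.sinh y * Real.cosh q →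
      Real.sinh e * Real.cosh c ≤ Real.sinh (e - y) * Real.cosh r + Real.sinh y * Real.cosh s →
      Real.sinh s * Real.cosh b ≤ Real.sinh (s - t) * Real.cosh (e - y)
        + Real.sinh t * Real.cosh c →
      Real.sinh s * Real.cosh f ≤ Real.sinh (s - t) * Real.cosh q
        + Real.sinh t * Real.cosh (p + r) := by
  have sp : 0 < Real.sinh p := Real.sinh_pos_iff.2 hp
  have sr : 0 < Real.sinh r := Real.sinh_pos_iff.2 hr
  have spr : 0 < Real.sinh (p + r) := Real.sinh_pos_iff.2 (by linarith)
  have se : 0 < Real.sinh e := Real.sinh_pos_iff.2 he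
  have ss : 0 < Real.sinh s := Real.sinh_pos_iff.2 (by linarith)
  have st : 0 < Real.sinh t := Real.sinh_pos_iff.2 ht
  have sst : 0 < Real.sinh (s - t) := Real.sinh_pos_iff.2 (by linarith)
  obtain ⟨y, hy, hratio⟩ := exists_sin_ratio Real.continuous_sinh Real.sinh_zero he
    (fun x h0 h1 => Real.sinh_pos_iff.2 h0) (mul_pos st spr) (mul_pos sst sp)
  refine ⟨y, ⟨hy.1.le, hy.2.le⟩, fun a b c f ha hb hf hfab H1 H2 H3 => ?_⟩
  have sey : 0 < Real.sinh (e - y) := Real.sinh_pos_iff.2 (by linarith [hy.2])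
  obtain ⟨α, hα⟩ : ∃ α, α = Real.sinh t * Real.sinh (p + r) := ⟨_, rfl⟩
  obtain ⟨γ, hγ⟩ : ∃ γ, γ = Real.sinh (s - t) * Real.sinh p := ⟨_, rfl⟩
  obtain ⟨δ, hδ⟩ : ∃ δ, δ = Real.sinh t * Real.sinh p := ⟨_, rfl⟩
  obtain ⟨k, hk⟩ : ∃ k, k = Real.sinh t * Real.sinh r := ⟨_, rfl⟩
  obtain ⟨m, hm⟩ : ∃ m, m = Real.sinh s * Real.sinh p := ⟨_, rfl⟩
  obtain ⟨N, hN⟩ : ∃ N, N = α * Real.sinh e / Real.sinh (e - y) := ⟨_, rfl⟩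
  rw [← hα, ← hγ] at hratio
  have hαpos : 0 < α := by rw [hα]; positivity
  have hγpos : 0 < γ := by rw [hγ]; positivity
  have hδpos : 0 < δ := by rw [hδ]; positivity
  have hkpos : 0 < k := by rw [hk]; positivity
  have hmpos : 0 < m := by rw [hm]; positivity
  have hNpos : 0 < N := by rw [hN]; positivity
  have N1 : N * Real.sinh (e - y) = α * Real.sinh e := by rw [hN]; field_simp
  have N2 : N * Real.sinh y = γ * Real.sinh e := by
    apply mul_right_cancel₀ sey.ne'
    linear_combination Real.sinh y * N1 + Real.sinh e * hratio
  have N3 : N * Real.cosh (e - y) = α * Real.cosh e + γ := by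
    apply mul_right_cancel₀ se.ne'
    have h1 : Real.sinh y = Real.sinh e * Real.cosh (e - y)
        - Real.cosh e * Real.sinh (e - y) := by
      rw [← Real.sinh_sub]; congr 1; ring
    rw [h1] at N2
    linear_combination N2 + Real.cosh e * N1
  have N4 : N ^ 2 = α ^ 2 + γ ^ 2 + 2 * α * γ * Real.cosh e := by
    have h1 := Real.cosh_sq (e - y)
    have h2 := Real.cosh_sq e
    linear_combination (-N ^ 2) * h1 - (N * Real.sinh (e - y) + α * Real.sinh e) * N1
      + (N * Real.cosh (e - y) + α * Real.cosh e + γ) * N3 + α ^ 2 * h2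
  have m2 : m ^ 2 = γ ^ 2 + δ ^ 2 + 2 * γ * δ * Real.cosh s := by
    have h1 := Real.cosh_sq s
    have h2 := Real.cosh_sq t
    rw [hm, hγ, hδ, Real.sinh_sub]
    linear_combination (Real.sinh p * Real.sinh t) ^ 2 * h1
      - (Real.sinh p * Real.sinh s) ^ 2 * h2
  have k2 : k ^ 2 = α ^ 2 + δ ^ 2 - 2 * α * δ * Real.cosh r := by
    have h1 := Real.cosh_sq r
    have h2 := Real.cosh_sq p
    rw [hk, hα, hδ, Real.sinh_add]
    linear_combination (Real.sinh t * Real.sinh p) ^ 2 * h1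
      - (Real.sinh t * Real.sinh r) ^ 2 * h2
  have ak : α * Real.cosh p - k = δ * Real.cosh (p + r) := by
    have h2 := Real.cosh_sq p
    rw [hα, hk, hδ, Real.sinh_add, Real.cosh_add]
    linear_combination Real.sinh t * Real.sinh r * h2
  have I1 : N * Real.cosh a ≤ α * Real.cosh p + γ * Real.cosh q := by
    refine le_of_mul_le_mul_right ?_ se
    have := mul_le_mul_of_nonneg_left H1 hNpos.le
    linear_combination this + Real.cosh p * N1 + Real.cosh q * N2
  have I2 : N * Real.cosh c ≤ α * Real.cosh r + γ * Real.cosh s := by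
    refine le_of_mul_le_mul_right ?_ se
    have := mul_le_mul_of_nonneg_left H2 hNpos.le
    linear_combination this + Real.cosh r * N1 + Real.cosh s * N2
  have I3 : 2 * (N * m * Real.cosh b) ≤ N ^ 2 + m ^ 2 - k ^ 2 := by
    have h1 := mul_le_mul_of_nonneg_left H3 (mul_pos hNpos sp).le
    have h2 := mul_le_mul_of_nonneg_left I2 hδpos.le
    rw [N4, m2, k2]
    have h3 : N * m * Real.cosh b
        ≤ γ * (α * Real.cosh e + γ) + δ * (α * Real.cosh r + γ * Real.cosh s) := by
      rw [← N3, hγ, hm]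
      rw [hδ] at h2 ⊢
      rw [hγ] at h2
      linarith
    linarith
  -- this is where `s ≤ e + r` enters; it makes `N - m * D` nonnegative below
  have I4 : m ^ 2 ≤ N ^ 2 + k ^ 2 := by
    have h1 : Real.cosh s ≤ Real.cosh (e + r) :=
      Real.cosh_le_cosh.2 (by rw [abs_of_pos (by linarith), abs_of_pos (by linarith)]; exact hser)
    have h2 : δ * Real.cosh (e + r) ≤ α * Real.cosh e := by
      have h3 : Real.cosh e * Real.sinh p * Real.cosh r + Real.sinh e * Real.sinh p * Real.sinh r
          ≤ Real.cosh e * Real.sinh (p + r) := by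
        rw [Real.sinh_add]
        have h4 : Real.sinh e * Real.sinh p ≤ Real.cosh e * Real.cosh p :=
          mul_le_mul (Real.sinh_lt_cosh e).le (Real.sinh_lt_cosh p).le sp.le (Real.cosh_pos e).le
        linarith [mul_le_mul_of_nonneg_right h4 sr.le]
      rw [hδ, hα, Real.cosh_add]
      linarith [mul_le_mul_of_nonneg_left h3 st.le]
    have h3 := mul_le_mul_of_nonneg_left h2 hγpos.le
    have h4 := mul_le_mul_of_nonneg_left h1 (mul_pos hγpos hδpos).le
    have h6 : δ * Real.cosh r ≤ α := by
      rw [hδ, hα, Real.sinh_add]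
      linarith [mul_pos st (mul_pos (Real.cosh_pos p) sr)]
    have h7 := mul_le_mul_of_nonneg_left h6 hαpos.le
    rw [N4, k2, m2]
    linarith
  -- `D` is the hyperbolic cosine of the distance from `x` to `M` in the model
  obtain ⟨D, hD⟩ : ∃ D, D = (N ^ 2 + m ^ 2 - k ^ 2) / (2 * (N * m)) := ⟨_, rfl⟩
  have hDmul : 2 * (N * m * D) = N ^ 2 + m ^ 2 - k ^ 2 := by rw [hD]; field_simp
  have hbD : Real.cosh b ≤ D := by
    rw [hD, le_div_iff₀ (by positivity)]; linarith
  have hD1 : 1 ≤ D := (Real.one_le_cosh b).trans hbD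
  have hsD : Real.sinh b ≤ √(D ^ 2 - 1) := by
    refine Real.le_sqrt_of_sq_le ?_
    have h1 := Real.cosh_sq b
    have h2 := pow_le_pow_left₀ (Real.cosh_pos b).le hbD 2
    linarith
  obtain ⟨z, hz⟩ : ∃ z, z = m * √(D ^ 2 - 1) := ⟨_, rfl⟩
  have hz2 : z ^ 2 = m ^ 2 * (D ^ 2 - 1) := by
    rw [hz, mul_pow, Real.sq_sqrt (sub_nonneg.2 (one_le_pow₀ hD1))]
  have hz0 : 0 ≤ z := by rw [hz]; positivity
  have hZ : (N - m * D) ^ 2 = k ^ 2 + z ^ 2 := by rw [hz2]; linear_combination -hDmul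
  have hZ0 : 0 ≤ N - m * D := by
    refine (mul_nonneg_iff_of_pos_left (show 0 < 2 * N by positivity)).1 ?_
    have : 2 * N * (N - m * D) = N ^ 2 + k ^ 2 - m ^ 2 := by linear_combination -hDmul
    linarith
  -- the reversed Cauchy-Schwarz inequality
  have hCS : k ≤ (N - m * D) * Real.cosh a - z * Real.sinh a := by
    have hzZ : z ≤ N - m * D := by
      refine abs_le_of_sq_le_sq' ?_ hZ0 |>.2
      rw [hZ]; exact le_add_of_nonneg_left (sq_nonneg k)
    have h0 : 0 ≤ (N - m * D) * Real.cosh a - z * Real.sinh a := by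
      have := mul_le_mul hzZ (Real.sinh_lt_cosh a).le (Real.sinh_nonneg_iff.2 ha) hZ0
      linarith
    refine abs_le_of_sq_le_sq' ?_ h0 |>.2
    have h1 := Real.cosh_sq a
    have h2 := sq_nonneg ((N - m * D) * Real.sinh a - z * Real.cosh a)
    have h3 : ((N - m * D) * Real.cosh a - z * Real.sinh a) ^ 2
        - ((N - m * D) * Real.sinh a - z * Real.cosh a) ^ 2 = k ^ 2 := by
      linear_combination hZ + ((N - m * D) ^ 2 - z ^ 2) * h1
    linarith
  have hfin : m * Real.cosh f ≤ γ * Real.cosh q + δ * Real.cosh (p + r) := by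
    have h1 : Real.cosh f ≤ Real.cosh (a + b) :=
      Real.cosh_le_cosh.2 (by rw [abs_of_nonneg hf, abs_of_nonneg (by linarith)]; exact hfab)
    rw [Real.cosh_add] at h1
    have h2 := mul_le_mul_of_nonneg_left hbD (Real.cosh_pos a).le
    have h3 := mul_le_mul_of_nonneg_left hsD (Real.sinh_nonneg_iff.2 ha)
    have h4 := mul_le_mul_of_nonneg_left (h1.trans (add_le_add h2 h3)) hmpos.le
    have h5 : m * (Real.cosh a * D + Real.sinh a * √(D ^ 2 - 1))
        = m * D * Real.cosh a + z * Real.sinh a := by rw [hz]; ring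
    rw [← ak]
    linarith
  rw [hγ, hδ, hm] at hfin
  refine le_of_mul_le_mul_right ?_ sp
  linarith

/-- The metric form of Alexandrov's lemma. Triangles `A P Q` and `P Q R` lie on different sides of
`P Q`, with `p = A P`, `q = A Q`, `e = P Q`, `r = P R`, `s = Q R`. The number `y` marks the point
`x` of `P Q` that lies on the segment from `A` to the point `M` of `Q R` at distance `t` from `Q`,
once `A P R` has been straightened. The sum of the comparison distances `a = A x` and `b = x M` is
at most the distance `A M` in the straightened triangle. -/
theorem exists_stewart_add {κ p q e r s t : ℝ} (hp : 0 < p) (he : 0 < e) (hr : 0 < r)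
    (ht : 0 < t) (hts : t < s) (hser : s ≤ e + r) (hpr : LTDivSqrt κ (p + r) Real.pi)
    (heκ : LTDivSqrt κ e Real.pi) (hsκ : LTDivSqrt κ s Real.pi) :
    ∃ y ∈ Icc 0 e, ∀ a b c f, 0 ≤ a → LEDivSqrt κ a Real.pi → 0 ≤ b → LEDivSqrt κ b Real.pi →
      0 ≤ f → LEDivSqrt κ f Real.pi → f ≤ a + b →
      Stewart κ e y p q a → Stewart κ e y r s c → Stewart κ s t (e - y) c b →
      Stewart κ s t q (p + r) f := by
  induction κ using curvature_cases with
  | pos ρ hρ =>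
    rw [ltDivSqrt_sq hρ] at hpr heκ hsκ
    rw [mul_add] at hpr
    obtain ⟨y, hy, H⟩ := alexandrov_sphere (q := ρ * q) (mul_pos hρ hp) (mul_pos hρ he)
      (mul_pos hρ hr) (mul_pos hρ ht) (mul_lt_mul_of_pos_left hts hρ) hpr heκ hsκ
    have hρy : ρ * (y / ρ) = y := by field_simp
    refine ⟨y / ρ, ⟨div_nonneg hy.1 hρ.le, by rw [div_le_iff₀ hρ]; linarith [hy.2]⟩, ?_⟩
    intro a b c f ha haκ hb hbκ hf hfκ hfab h1 h2 h3
    rw [leDivSqrt_sq hρ] at haκ hbκ hfκ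
    rw [stewart_of_pos_iff hρ] at h1 h2 h3 ⊢
    simp only [mul_sub, mul_add, hρy] at h1 h2 h3 ⊢
    exact H (ρ * a) (ρ * b) (ρ * c) (ρ * f) (by positivity) haκ (by positivity) hbκ (by positivity)
      hfκ (by rw [← mul_add]; gcongr) h1 h2 h3
  | zero =>
    obtain ⟨y, hy, H⟩ := alexandrov_plane (q := q) hp he hr ht hts
    refine ⟨y, hy, ?_⟩
    intro a b c f ha _ hb _ hf _ hfab h1 h2 h3
    rw [stewart_curv_zero_iff] at h1 h2 h3 ⊢
    exact H a b c f ha hb hf hfab h1 h2 h3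
  | neg ρ hρ =>
    obtain ⟨y, hy, H⟩ := alexandrov_hyperbolic (q := ρ * q) (mul_pos hρ hp) (mul_pos hρ he)
      (mul_pos hρ hr) (mul_pos hρ ht) (mul_lt_mul_of_pos_left hts hρ)
      (by rw [← mul_add]; exact mul_le_mul_of_nonneg_left hser hρ.le)
    have hρy : ρ * (y / ρ) = y := by field_simp
    refine ⟨y / ρ, ⟨div_nonneg hy.1 hρ.le, by rw [div_le_iff₀ hρ]; linarith [hy.2]⟩, ?_⟩
    intro a b c f ha _ hb _ hf _ hfab h1 h2 h3
    rw [stewart_of_neg_iff hρ] at h1 h2 h3 ⊢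
    simp only [mul_sub, mul_add, hρy] at h1 h2 h3 ⊢
    exact H (ρ * a) (ρ * b) (ρ * c) (ρ * f) (by positivity) (by positivity) (by positivity)
      (by rw [← mul_add]; gcongr) h1 h2 h3

/-! ### Geodesics and gluing -/

theorem Stewart.symm {κ ℓ s a b d : ℝ} (h : Stewart κ ℓ s a b d) : Stewart κ ℓ (ℓ - s) b a d := by
  unfold Stewart stewartBound at *
  rw [sub_sub_cancel]
  linarith

/-- Equality holds in Stewart's inequality if the apex lies on the line of the segment. -/
theorem stewart_collinear (κ p s t : ℝ) : Stewart κ s t p (p + s) (p + t) := by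
  refine le_of_eq ?_
  have hs : s = t + (s - t) := by ring
  generalize s - t = u at *
  subst hs
  have h1 := gcos_sq_add κ (t / 2)
  have h2 := gcos_sq_add κ (u / 2)
  rw [stewartBound, add_sub_cancel_left, gver_add κ p, gver_add κ p]
  unfold gver
  rw [gsin_eq_half κ (t + u), gsin_eq_half κ t, gsin_eq_half κ u, gcos_eq_gver κ p, gver]
  simp only [add_div, gsin_add, gcos_add]
  generalize gsin κ (t / 2) = a at *
  generalize gcos κ (t / 2) = b at *
  generalize gsin κ (u / 2) = c at *
  generalize gcos κ (u / 2) = d at *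
  generalize gsin κ (p / 2) = e at *
  linear_combination
    (4 * c * d * e ^ 2 + (8 * κ * e ^ 2 - 4) * (a * b * c ^ 2 + a ^ 2 * c * d)) * h1
    + (4 * a * b * e ^ 2) * h2

section Segments

variable {X : Type*} [MetricSpace X]

/-- The map `φ` restricts to a geodesic on `[u, v]`. -/
def IsGeodesicOn (φ : ℝ → X) (u v : ℝ) : Prop :=
  ∀ s ∈ Icc u v, ∀ t ∈ Icc u v, dist (φ s) (φ t) = |s - t|

theorem IsGeodesicOn.mono {φ : ℝ → X} {u v u' v' : ℝ} (h : IsGeodesicOn φ u v) (hu : u ≤ u')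
    (hv : v' ≤ v) : IsGeodesicOn φ u' v' :=
  fun s hs t ht => h s ⟨hu.trans hs.1, hs.2.trans hv⟩ t ⟨hu.trans ht.1, ht.2.trans hv⟩

theorem IsGeodesicOn.dist_eq {φ : ℝ → X} {u v s t : ℝ} (h : IsGeodesicOn φ u v) (hu : u ≤ s)
    (hst : s ≤ t) (hv : t ≤ v) : dist (φ s) (φ t) = t - s := by
  rw [h s ⟨hu, hst.trans hv⟩ t ⟨hu.trans hst, hv⟩, abs_sub_comm, abs_of_nonneg (by linarith)]

theorem IsGeodesicOn.continuousOn {φ : ℝ → X} {u v : ℝ} (h : IsGeodesicOn φ u v) :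
    ContinuousOn φ (Icc u v) := by
  have : LipschitzOnWith 1 φ (Icc u v) := by
    refine LipschitzOnWith.of_dist_le_mul fun s hs t ht => ?_
    rw [h s hs t ht, Real.dist_eq]; simp
  exact this.continuousOn

theorem IsGeodesicFromTo.isGeodesicOn {φ : ℝ → X} {x y : X} (h : IsGeodesicFromTo φ x y) :
    IsGeodesicOn φ 0 (dist x y) := h.dist_eq

theorem IsGeodesicFromTo.dist_left {φ : ℝ → X} {x y : X} (h : IsGeodesicFromTo φ x y) {s : ℝ}
    (hs : s ∈ Icc 0 (dist x y)) : dist x (φ s) = s := by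
  have := h.isGeodesicOn.dist_eq le_rfl hs.1 hs.2
  rwa [h.source, sub_zero] at this

theorem IsGeodesicFromTo.dist_right {φ : ℝ → X} {x y : X} (h : IsGeodesicFromTo φ x y) {s : ℝ}
    (hs : s ∈ Icc 0 (dist x y)) : dist (φ s) y = dist x y - s := by
  have := h.isGeodesicOn.dist_eq hs.1 hs.2 le_rfl
  rwa [h.target] at this

theorem IsGeodesicOn.isGeodesicFromTo {φ : ℝ → X} {u v : ℝ} (huv : u ≤ v)
    (h : IsGeodesicOn φ u v) : IsGeodesicFromTo (fun t => φ (u + t)) (φ u) (φ v) := by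
  have hd := h.dist_eq le_rfl huv le_rfl
  refine ⟨by simp, by simp [hd], ?_⟩
  rw [hd]
  intro s hs t ht
  rw [h (u + s) ⟨by linarith [hs.1], by linarith [hs.2]⟩ (u + t)
    ⟨by linarith [ht.1], by linarith [ht.2]⟩]
  congr 1; ring

/-- Stewart's inequality holds for all apices and all geodesics of the space. -/
def SatisfiesStewart (κ : ℝ) (X : Type*) [MetricSpace X] : Prop :=
  ∀ (A x y : X) (γ : ℝ → X), IsGeodesicFromTo γ x y → ∀ s ∈ Icc 0 (dist x y),
    Stewart κ (dist x y) s (dist A x) (dist A y) (dist A (γ s))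

variable {κ : ℝ}

theorem SatisfiesStewart.stewart_midpoint (hX : SatisfiesStewart κ X) (A : X) {φ : ℝ → X} {t h : ℝ}
    (hh : 0 ≤ h) (hφ : IsGeodesicOn φ (t - h) (t + h)) :
    Stewart κ (2 * h) h (dist A (φ (t - h))) (dist A (φ (t + h))) (dist A (φ t)) := by
  have h1 := hφ.isGeodesicFromTo (by linarith)
  have h2 : dist (φ (t - h)) (φ (t + h)) = 2 * h := by
    rw [hφ.dist_eq le_rfl (by linarith) le_rfl]; ring
  have := hX A _ _ _ h1 h (by rw [h2]; constructor <;> linarith)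
  rwa [h2, sub_add_cancel] at this

theorem dist_eq_zero_of_stewart {ℓ s d : ℝ} (hℓ : 0 < ℓ) (hκ : LTDivSqrt κ ℓ Real.pi)
    (hd : 0 ≤ d) (hdκ : LEDivSqrt κ d Real.pi) (h : Stewart κ ℓ s s (ℓ - s) d) : d = 0 := by
  rw [Stewart, stewartBound_degenerate] at h
  have h1 := gsin_pos hℓ hκ
  have h2 : gver κ d ≤ gver κ 0 := by
    rw [gver_zero]
    by_contra! hcon
    exact absurd h (not_le.2 (mul_pos h1 hcon))
  exact le_antisymm (le_of_gver_le le_rfl hdκ h2) hd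

/-- A point at the right distances from the ends of a geodesic lies on it. -/
theorem SatisfiesStewart.eq_of_dist_eq (hX : SatisfiesStewart κ X)
    (hsize : ∀ x y : X, LTDivSqrt κ (dist x y) Real.pi) {x y z : X} {γ : ℝ → X}
    (hγ : IsGeodesicFromTo γ x y) {s : ℝ} (hs : s ∈ Icc 0 (dist x y)) (h1 : dist z x = s)
    (h2 : dist z y = dist x y - s) : z = γ s := by
  rcases (dist_nonneg (x := x) (y := y)).eq_or_lt with h0 | h0
  · have hs0 : s = 0 := le_antisymm (hs.2.trans h0.ge) hs.1
    rw [hs0, hγ.source]; exact dist_eq_zero.1 (h1.trans hs0)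
  · have := hX z x y γ hγ s hs
    rw [h1, h2] at this
    exact dist_eq_zero.1 (dist_eq_zero_of_stewart h0 (hsize x y) dist_nonneg (hsize _ _).le this)

/-- Alexandrov's lemma for a function `F` that behaves like the distance from an apex. If `F`
satisfies Stewart's inequality along a geodesic from `P` to `Q`, then, in the limit where the apex
sees `R` through `P`, it also does so along a geodesic from `Q` to `R`. -/
theorem SatisfiesStewart.stewart_alexandrov (hX : SatisfiesStewart κ X)
    (hsize : ∀ x y : X, LTDivSqrt κ (dist x y) Real.pi) {F : X → ℝ}
    (hF : ∀ x y, F y ≤ F x + dist x y) (hF' : ∀ x y, dist x y ≤ F x + F y)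
    (hFκ : ∀ x, LEDivSqrt κ (F x) Real.pi) {P Q R : X} {η φ : ℝ → X}
    (hη : IsGeodesicFromTo η P Q) (hφ : IsGeodesicFromTo φ Q R) {q : ℝ} (hq : F Q ≤ q)
    (hqκ : LEDivSqrt κ q Real.pi) (hpr : LTDivSqrt κ (F P + dist P R) Real.pi)
    (H : ∀ y ∈ Icc 0 (dist P Q), Stewart κ (dist P Q) y (F P) q (F (η y))) {t : ℝ}
    (ht : t ∈ Icc 0 (dist Q R)) :
    Stewart κ (dist Q R) t q (F P + dist P R) (F (φ t)) := by
  have hF0 : ∀ x, 0 ≤ F x := fun x => by have := hF' x x; rw [dist_self] at this; linarith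
  have hs0 : 0 ≤ gsin κ (dist Q R) := gsin_nonneg dist_nonneg (hsize _ _).le
  have hq0 : 0 ≤ q := (hF0 Q).trans hq
  rcases ht.1.eq_or_lt with rfl | ht0
  · rw [Stewart, stewartBound_zero, hφ.source]
    exact mul_le_mul_of_nonneg_left (gver_le_gver (hF0 _) hq hqκ) hs0
  rcases ht.2.eq_or_lt with rfl | hts
  · rw [Stewart, stewartBound_self, hφ.target]
    exact mul_le_mul_of_nonneg_left (gver_le_gver (hF0 _) (hF P R) hpr.le) hs0
  rcases (dist_nonneg (x := P) (y := Q)).eq_or_lt with he | he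
  · obtain rfl := dist_eq_zero.1 he.symm
    have h1 := stewart_collinear κ (F P) (dist P R) t
    have h2 : F (φ t) ≤ F P + t := by
      have := hF P (φ t); rwa [hφ.dist_left ht] at this
    exact h1.mono ht (hsize _ _).le (hF0 _) h2 (hpr.le.mono (by linarith)) (hF0 _) hq hqκ
      (by linarith [hF0 P]) le_rfl hpr.le
  rcases (hF0 P).eq_or_lt with hp | hp
  · have h1 := hX P Q R φ hφ t ht
    have h2 := hF P (φ t)
    have h3 := hF' P Q
    rw [← hp, zero_add] at h2 h3
    rw [← hp, zero_add] at hpr ⊢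
    exact h1.mono ht (hsize _ _).le (hF0 _) h2 (hsize _ _).le dist_nonneg (h3.trans hq) hqκ
      dist_nonneg le_rfl hpr.le
  rcases (dist_nonneg (x := P) (y := R)).eq_or_lt with hr | hr
  · obtain rfl := dist_eq_zero.1 hr.symm
    have h1 : dist P Q - t ∈ Icc 0 (dist P Q) := by
      rw [dist_comm P Q]; exact ⟨by linarith, by linarith⟩
    have h2 : φ t = η (dist P Q - t) := by
      refine hX.eq_of_dist_eq hsize hη h1 ?_ ?_
      · rw [hφ.dist_right ht, dist_comm]
      · rw [dist_comm, hφ.dist_left ht]; ring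
    have h3 := (H _ h1).symm
    rw [sub_sub_cancel, ← h2, dist_comm] at h3
    rwa [dist_self, add_zero]
  obtain ⟨y, hy, h⟩ := exists_stewart_add (κ := κ) (q := q) hp he hr ht0 hts
    (by rw [dist_comm P Q]; exact dist_triangle Q P R) hpr (hsize P Q) (hsize Q R)
  refine h (F (η y)) (dist (η y) (φ t)) (dist (η y) R) (F (φ t)) (hF0 _) (hFκ _) dist_nonneg
    (hsize _ _).le (hF0 _) (hFκ _) (hF _ _) (H y hy) ?_ ?_
  · have := hX R P Q η hη y hy
    rwa [dist_comm R P, dist_comm R Q, dist_comm R] at this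
  · have := hX (η y) Q R φ hφ t ht
    rwa [hη.dist_right hy] at this

/-- The distance from `A` to `x` in the space obtained by gluing two copies of `X` along `Δ`, where
`A` and `x` lie in different copies. -/
noncomputable def gluedDist (Δ : Set X) (A x : X) : ℝ := ⨅ w : Δ, (dist A w + dist (w : X) x)

variable {Δ : Set X}

theorem bddBelow_range_gluedDist (A x : X) :
    BddBelow (range fun w : Δ => dist A w + dist (w : X) x) :=
  ⟨0, by rintro _ ⟨w, rfl⟩; positivity⟩

theorem gluedDist_le {w : X} (hw : w ∈ Δ) (A x : X) : gluedDist Δ A x ≤ dist A w + dist w x :=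
  ciInf_le (bddBelow_range_gluedDist A x) ⟨w, hw⟩

theorem le_gluedDist (hΔ : Δ.Nonempty) {A x : X} {c : ℝ}
    (h : ∀ w ∈ Δ, c ≤ dist A w + dist w x) : c ≤ gluedDist Δ A x := by
  have := hΔ.to_subtype
  exact le_ciInf fun w => h w w.2

theorem dist_le_gluedDist (hΔ : Δ.Nonempty) (A x : X) : dist A x ≤ gluedDist Δ A x :=
  le_gluedDist hΔ fun w _ => dist_triangle _ w _

theorem gluedDist_of_mem {w : X} (hw : w ∈ Δ) (A : X) : gluedDist Δ A w = dist A w :=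
  le_antisymm (by simpa using gluedDist_le hw A w) (dist_le_gluedDist ⟨w, hw⟩ A w)

theorem gluedDist_le_add (hΔ : Δ.Nonempty) (A x y : X) :
    gluedDist Δ A y ≤ gluedDist Δ A x + dist x y := by
  rw [← sub_le_iff_le_add]
  refine le_gluedDist hΔ fun w hw => ?_
  have h1 := gluedDist_le hw A y
  have h2 := dist_triangle w x y
  linarith

theorem exists_seq_tendsto_gluedDist (hΔ : Δ.Nonempty) (A x : X) : ∃ w : ℕ → X, (∀ n, w n ∈ Δ) ∧
    Filter.Tendsto (fun n => dist A (w n) + dist (w n) x) Filter.atTop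
      (𝓝 (gluedDist Δ A x)) := by
  have := hΔ.to_subtype
  obtain ⟨u, -, hu, hmem⟩ := exists_seq_tendsto_sInf
    (range_nonempty fun w : Δ => dist A w + dist (w : X) x) (bddBelow_range_gluedDist A x)
  choose w hw using hmem
  refine ⟨fun n => w n, fun n => (w n).2, ?_⟩
  simp only [hw]
  exact hu

theorem lt_half_add {x y c : ℝ} (hx : LTDivSqrt κ x (c / 2)) (hy : LTDivSqrt κ y (c / 2)) :
    LTDivSqrt κ (x + y) c := by
  intro hκ
  have h1 := hx hκ
  have h2 := hy hκ
  rw [div_right_comm] at h1 h2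
  linarith

theorem LTDivSqrt.of_half {x : ℝ} (h : LTDivSqrt κ x (Real.pi / 2)) : LTDivSqrt κ x Real.pi :=
  h.mono_right (by linarith [Real.pi_pos])

/-- Reshetnyak's gluing theorem, for a geodesic in one copy of `X` and an apex in the other. -/
theorem SatisfiesStewart.stewart_gluedDist (hX : SatisfiesStewart κ X) (hgeo : IsGeodesicSpace X)
    (hsize : ∀ x y : X, LTDivSqrt κ (dist x y) (Real.pi / 2)) (hΔ : Δ.Nonempty)
    (hconv : IsGeodesicallyConvex Δ) (A : X) {x y : X} {γ : ℝ → X} (hγ : IsGeodesicFromTo γ x y)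
    {t : ℝ} (ht : t ∈ Icc 0 (dist x y)) :
    Stewart κ (dist x y) t (gluedDist Δ A x) (gluedDist Δ A y) (gluedDist Δ A (γ t)) := by
  have hsize' : ∀ x y : X, LTDivSqrt κ (dist x y) Real.pi := fun x y => (hsize x y).of_half
  have hF := gluedDist_le_add hΔ A
  have hF' : ∀ x y, dist x y ≤ gluedDist Δ A x + gluedDist Δ A y := fun x y => by
    have h1 := dist_le_gluedDist hΔ A x
    have h2 := dist_le_gluedDist hΔ A y
    have h3 := dist_triangle_left x y A
    linarith
  have hFκ : ∀ x, LEDivSqrt κ (gluedDist Δ A x) Real.pi := fun x => by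
    obtain ⟨w, hw⟩ := hΔ
    exact (lt_half_add (hsize A w) (hsize w x)).le.mono (gluedDist_le hw A x)
  obtain ⟨u, hu, hu'⟩ := exists_seq_tendsto_gluedDist hΔ A x
  obtain ⟨v, hv, hv'⟩ := exists_seq_tendsto_gluedDist hΔ A y
  have key : ∀ n, Stewart κ (dist x y) t (dist A (u n) + dist (u n) x)
      (dist A (v n) + dist (v n) y) (gluedDist Δ A (γ t)) := by
    intro n
    obtain ⟨⟨η, hη⟩, hηΔ⟩ := hconv (u n) (hu n) (v n) (hv n)
    obtain ⟨θ, hθ⟩ := hgeo (v n) x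
    have hsum := fun w z => lt_half_add (hsize A w) (hsize w z)
    have h1 : ∀ s ∈ Icc 0 (dist (v n) x), Stewart κ (dist (v n) x) s (dist A (v n))
        (dist A (u n) + dist (u n) x) (gluedDist Δ A (θ s)) := by
      intro s hs
      have := hX.stewart_alexandrov hsize' hF hF' hFκ hη hθ (q := dist A (v n))
        (gluedDist_of_mem (hv n) A).le (hsize' _ _).le
        (by rw [gluedDist_of_mem (hu n)]; exact hsum _ _) (by
          intro s hs
          rw [gluedDist_of_mem (hu n), gluedDist_of_mem (hηΔ η hη s hs)]
          exact hX A _ _ η hη s hs) hs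
      rwa [gluedDist_of_mem (hu n)] at this
    have := hX.stewart_alexandrov hsize' hF hF' hFκ hθ hγ
      (q := dist A (u n) + dist (u n) x) (gluedDist_le (hu n) A x) (hsum _ _).le
      (by rw [gluedDist_of_mem (hv n)]; exact hsum _ _) (by
        rwa [gluedDist_of_mem (hv n)]) ht
    rwa [gluedDist_of_mem (hv n)] at this
  have hcv := continuous_gver κ
  have hlim : Filter.Tendsto (fun n => stewartBound κ (dist x y) t (dist A (u n) + dist (u n) x)
      (dist A (v n) + dist (v n) y)) Filter.atTop
      (𝓝 (stewartBound κ (dist x y) t (gluedDist Δ A x) (gluedDist Δ A y))) := by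
    unfold stewartBound
    exact (((hcv.tendsto _).comp hu').const_mul _ |>.add
      (((hcv.tendsto _).comp hv').const_mul _)).sub_const _
  exact ge_of_tendsto' hlim key

/-- In a space where Stewart's inequality holds, geodesics depend continuously on an endpoint. -/
theorem SatisfiesStewart.continuous_geodesic (hX : SatisfiesStewart κ X)
    (hsize : ∀ x y : X, LTDivSqrt κ (dist x y) Real.pi) (A : X) {g : X → ℝ → X}
    (hg : ∀ x, IsGeodesicFromTo (g x) A x) :
    Continuous fun p : unitInterval × X => g p.2 (p.1 * dist A p.2) := by
  rw [continuous_iff_continuousAt]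
  rintro ⟨t₀, x₀⟩
  have hmem : ∀ p : unitInterval × X, (p.1 : ℝ) * dist A p.2 ∈ Icc 0 (dist A p.2) := fun p =>
    ⟨mul_nonneg p.1.2.1 dist_nonneg, mul_le_of_le_one_left dist_nonneg p.1.2.2⟩
  have hlim : Filter.Tendsto (fun p : unitInterval × X => (p.1 : ℝ) * dist A p.2) (𝓝 (t₀, x₀))
      (𝓝 ((t₀ : ℝ) * dist A x₀)) := by
    refine Continuous.tendsto (f := fun p : unitInterval × X => (p.1 : ℝ) * dist A p.2) ?_ (t₀, x₀)
    fun_prop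
  have ha : Filter.Tendsto (fun p : unitInterval × X => dist (g p.2 (p.1 * dist A p.2)) A)
      (𝓝 (t₀, x₀)) (𝓝 ((t₀ : ℝ) * dist A x₀)) := by
    refine hlim.congr fun p => ?_
    rw [dist_comm _ A, (hg p.2).dist_left (hmem p)]
  rw [ContinuousAt, tendsto_iff_dist_tendsto_zero]
  rcases (dist_nonneg (x := A) (y := x₀)).eq_or_lt with h0 | h0
  · rw [← h0, mul_zero] at ha
    rwa [← h0, mul_zero, (hg x₀).source]
  · refine tendsto_zero_of_stewart h0 (hsize A x₀) ha (b := fun p => dist (g p.2 _) x₀) ?_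
      (fun _ => dist_nonneg) (fun p => (hsize _ _).le)
      (fun p => hX _ A x₀ (g x₀) (hg x₀) (t₀ * dist A x₀) (hmem (t₀, x₀)))
    have hu : Filter.Tendsto (fun p : unitInterval × X => dist A p.2 - p.1 * dist A p.2
        + dist p.2 x₀) (𝓝 (t₀, x₀)) (𝓝 (dist A x₀ - t₀ * dist A x₀ + dist x₀ x₀)) := by
      refine Continuous.tendsto (f := fun p : unitInterval × X => dist A p.2 - p.1 * dist A p.2
        + dist p.2 x₀) ?_ (t₀, x₀)
      fun_prop
    rw [dist_self, add_zero] at hu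
    refine tendsto_of_tendsto_of_tendsto_of_le_of_le (hlim.const_sub (dist A x₀)) hu ?_ ?_
    · intro p
      have h1 := dist_triangle A (g p.2 (p.1 * dist A p.2)) x₀
      rw [(hg p.2).dist_left (hmem p)] at h1
      simp only; linarith
    · intro p
      have h1 := dist_triangle (g p.2 (p.1 * dist A p.2)) p.2 x₀
      rw [(hg p.2).dist_right (hmem p)] at h1
      simpa using h1

end Segments

/-! ### The model surfaces -/

namespace ModelPlane

variable {κ : ℝ}

theorem form_comm (p q : ModelPlane κ) : p.form q = q.form p := by unfold form; ring

theorem form_self (p : ModelPlane κ) : p.form p = 1 := by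
  have := p.eqn; unfold form; linarith

theorem dist_comm' (p q : ModelPlane κ) : dist p q = dist q p := by
  simp only [dist, form_comm q p]
  rw [show (q.x - p.x) ^ 2 + (q.y - p.y) ^ 2 = (p.x - q.x) ^ 2 + (p.y - q.y) ^ 2 by ring]

theorem dist_leDivSqrt (p q : ModelPlane κ) : LEDivSqrt κ (dist p q) Real.pi := by
  intro hκ
  simp only [dist, if_pos hκ]
  gcongr
  exact Real.arccos_le_pi _

theorem z_eq_one (p : ModelPlane 0) : p.z = 1 := by
  have h := p.eqn
  have := p.pos le_rfl
  nlinarith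

theorem sq_dist_zero (p q : ModelPlane 0) :
    dist p q ^ 2 = (p.x - q.x) ^ 2 + (p.y - q.y) ^ 2 := by
  simp only [dist, lt_irrefl, if_false, if_true]
  rw [Real.sq_sqrt (by positivity)]

theorem one_le_form (hκ : κ < 0) (p q : ModelPlane κ) : 1 ≤ p.form q := by
  have h1 := p.eqn
  have h2 := q.eqn
  have h3 := p.pos hκ.le
  have h4 := q.pos hκ.le
  have hκ' : 0 < -κ := by linarith
  have e : (p.z * q.z) ^ 2 - (1 - κ * (p.x * q.x + p.y * q.y)) ^ 2
      = -κ * ((p.x - q.x) ^ 2 + (p.y - q.y) ^ 2) + κ ^ 2 * (p.x * q.y - p.y * q.x) ^ 2 := by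
    have e1 : p.z ^ 2 = 1 - κ * (p.x ^ 2 + p.y ^ 2) := by linarith
    have e2 : q.z ^ 2 = 1 - κ * (q.x ^ 2 + q.y ^ 2) := by linarith
    rw [mul_pow, e1, e2]; ring
  have e' : 0 ≤ -κ * ((p.x - q.x) ^ 2 + (p.y - q.y) ^ 2)
      + κ ^ 2 * (p.x * q.y - p.y * q.x) ^ 2 := by positivity
  have := (abs_le_of_sq_le_sq' (show (1 - κ * (p.x * q.x + p.y * q.y)) ^ 2 ≤ (p.z * q.z) ^ 2 by
    linarith) (by positivity)).2
  unfold form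
  linarith

theorem dist_nonneg' (p q : ModelPlane κ) : 0 ≤ dist p q := by
  simp only [dist]
  split_ifs with h1 h2
  · exact div_nonneg (Real.arccos_nonneg _) (Real.sqrt_nonneg _)
  · exact Real.sqrt_nonneg _
  · exact div_nonneg (Real.arcosh_nonneg
      (one_le_form (lt_of_le_of_ne (not_lt.1 h1) h2) p q)) (Real.sqrt_nonneg _)

theorem gcos_dist (hκ : κ ≠ 0) (p q : ModelPlane κ) : gcos κ (dist p q) = p.form q := by
  rcases lt_or_gt_of_ne hκ with h | h
  · have hd : dist p q = Real.arcosh (p.form q) / √(-κ) := by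
      simp only [dist, if_neg h.le.not_gt, if_neg hκ]
    have hs : √(-κ) ≠ 0 := (Real.sqrt_pos.2 (by linarith)).ne'
    rw [gcos, if_neg h.le.not_gt, if_neg hκ, hd, mul_div_cancel₀ _ hs,
      Real.cosh_arcosh (one_le_form h p q)]
  · have hd : dist p q = Real.arccos (p.form q) / √κ := by simp only [dist, if_pos h]
    have hs : √κ ≠ 0 := (Real.sqrt_pos.2 h).ne'
    have h1 := p.eqn
    have h2 := q.eqn
    have e1 : 0 ≤ κ * ((p.x - q.x) ^ 2 + (p.y - q.y) ^ 2) + (p.z - q.z) ^ 2 := by positivity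
    have e2 : 0 ≤ κ * ((p.x + q.x) ^ 2 + (p.y + q.y) ^ 2) + (p.z + q.z) ^ 2 := by positivity
    rw [gcos, if_pos h, hd, mul_div_cancel₀ _ hs, Real.cos_arccos] <;> unfold form <;> linarith

/-- A distance in the model surface is determined by the bilinear form, or, for `κ = 0`, by
Pythagoras' theorem. -/
theorem dist_eq_of_form {p q : ModelPlane κ} {a : ℝ} (ha : 0 ≤ a) (haκ : LEDivSqrt κ a Real.pi)
    (h : p.form q = gcos κ a) (h0 : κ = 0 → (p.x - q.x) ^ 2 + (p.y - q.y) ^ 2 = a ^ 2) :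
    dist p q = a := by
  rcases eq_or_ne κ 0 with rfl | hκ
  · have := sq_dist_zero p q
    rw [h0 rfl] at this
    exact (pow_left_inj₀ (dist_nonneg' p q) ha two_ne_zero).1 this
  · rw [← gcos_dist hκ, gcos_eq_gver, gcos_eq_gver] at h
    refine gver_injective (dist_nonneg' p q) (dist_leDivSqrt p q) ha haκ ?_
    exact mul_left_cancel₀ hκ (by linarith)

theorem form_eq_gcos_dist (p q : ModelPlane κ) : p.form q = gcos κ (dist p q) := by
  rcases eq_or_ne κ 0 with rfl | hκ
  · simp [form, z_eq_one]
  · exact (gcos_dist hκ p q).symm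

theorem gsin_add_sq (κ s u : ℝ) :
    gsin κ (s + u) ^ 2
      = gsin κ u ^ 2 + gsin κ s ^ 2 + 2 * gsin κ u * gsin κ s * gcos κ (s + u) := by
  have h1 := gcos_sq_add κ s
  have h2 := gcos_sq_add κ u
  rw [gsin_add, gcos_add]
  linear_combination (gsin κ u ^ 2) * h1 + (gsin κ s ^ 2) * h2

/-- The bilinear form is definite, or Lorentzian and definite on the tangent planes. -/
theorem eq_zero_of_null {vx vy vz : ℝ} (g : ModelPlane κ)
    (hnull : κ * (vx ^ 2 + vy ^ 2) + vz ^ 2 = 0)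
    (horth : κ * (vx * g.x + vy * g.y) + vz * g.z = 0) (h0 : κ = 0 → vx ^ 2 + vy ^ 2 = 0) :
    vx = 0 ∧ vy = 0 ∧ vz = 0 := by
  suffices h : vx ^ 2 + vy ^ 2 = 0 by
    have hz : vz ^ 2 = 0 := by rw [h] at hnull; linarith
    have hx : vx ^ 2 = 0 := by linarith [sq_nonneg vx, sq_nonneg vy]
    have hy : vy ^ 2 = 0 := by linarith
    exact ⟨pow_eq_zero_iff two_ne_zero |>.1 hx, pow_eq_zero_iff two_ne_zero |>.1 hy,
      pow_eq_zero_iff two_ne_zero |>.1 hz⟩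
  rcases lt_trichotomy κ 0 with hκ | hκ | hκ
  · have e1 : vz ^ 2 = -κ * (vx ^ 2 + vy ^ 2) := by linarith
    have e2 : g.z ^ 2 = 1 + -κ * (g.x ^ 2 + g.y ^ 2) := by have := g.eqn; linarith
    have e3 : vz ^ 2 * g.z ^ 2 = (-κ) ^ 2 * (vx * g.x + vy * g.y) ^ 2 := by
      rw [← mul_pow, show vz * g.z = -κ * (vx * g.x + vy * g.y) by linarith]; ring
    have e4 : -κ * (vx ^ 2 + vy ^ 2) + (-κ) ^ 2 * (vx * g.y - vy * g.x) ^ 2 = 0 := by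
      rw [e2, e1] at e3
      linear_combination e3
    have e5 : 0 ≤ (-κ) ^ 2 * (vx * g.y - vy * g.x) ^ 2 := by positivity
    have e6 : 0 ≤ -κ * (vx ^ 2 + vy ^ 2) := mul_nonneg (by linarith) (by positivity)
    exact (mul_eq_zero.1 (show -κ * (vx ^ 2 + vy ^ 2) = 0 by linarith)).resolve_left
      (by linarith)
  · exact h0 hκ
  · have h1 : 0 ≤ κ * (vx ^ 2 + vy ^ 2) := by positivity
    exact (mul_eq_zero.1 (show κ * (vx ^ 2 + vy ^ 2) = 0 by linarith [sq_nonneg vz])).resolve_left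
      hκ.ne'

/-- A point that divides a segment is the linear combination of the ends with sine weights. -/
theorem combination_of_dist {p q g : ModelPlane κ} {s : ℝ} (h1 : dist p g = s)
    (h2 : dist g q = dist p q - s) :
    gsin κ (dist p q) * g.x = gsin κ (dist p q - s) * p.x + gsin κ s * q.x ∧
    gsin κ (dist p q) * g.y = gsin κ (dist p q - s) * p.y + gsin κ s * q.y ∧
    gsin κ (dist p q) * g.z = gsin κ (dist p q - s) * p.z + gsin κ s * q.z := by
  have f1 := form_eq_gcos_dist p g
  have f2 := form_eq_gcos_dist g q
  have f3 := form_eq_gcos_dist p q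
  have n1 := form_self p
  have n2 := form_self q
  have n3 := form_self g
  rw [h1] at f1
  rw [h2] at f2
  have d0 : κ = 0 → (p.x - g.x) ^ 2 + (p.y - g.y) ^ 2 = s ^ 2 ∧
      (g.x - q.x) ^ 2 + (g.y - q.y) ^ 2 = (dist p q - s) ^ 2 ∧
      (p.x - q.x) ^ 2 + (p.y - q.y) ^ 2 = dist p q ^ 2 := by
    rintro rfl
    rw [← sq_dist_zero, ← sq_dist_zero, ← sq_dist_zero, h1, h2]
    exact ⟨rfl, rfl, rfl⟩
  generalize dist p q = ℓ at *
  obtain ⟨u, rfl⟩ : ∃ u, ℓ = s + u := ⟨ℓ - s, by ring⟩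
  simp only [add_sub_cancel_left] at *
  obtain ⟨vx, hvx⟩ : ∃ v, v = gsin κ (s + u) * g.x - gsin κ u * p.x - gsin κ s * q.x := ⟨_, rfl⟩
  obtain ⟨vy, hvy⟩ : ∃ v, v = gsin κ (s + u) * g.y - gsin κ u * p.y - gsin κ s * q.y := ⟨_, rfl⟩
  obtain ⟨vz, hvz⟩ : ∃ v, v = gsin κ (s + u) * g.z - gsin κ u * p.z - gsin κ s * q.z := ⟨_, rfl⟩
  suffices h : vx = 0 ∧ vy = 0 ∧ vz = 0 by
    obtain ⟨e1, e2, e3⟩ := h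
    refine ⟨?_, ?_, ?_⟩ <;> linarith
  refine eq_zero_of_null g ?_ ?_ ?_
  · have hS := gsin_add_sq κ s u
    have hs : gsin κ (s + u) * (gsin κ u * gcos κ s + gsin κ s * gcos κ u)
        = gsin κ (s + u) ^ 2 := by rw [gsin_add]; ring
    unfold form at *
    rw [hvx, hvy, hvz]
    linear_combination gsin κ (s + u) ^ 2 * n3 + gsin κ u ^ 2 * n1 + gsin κ s ^ 2 * n2
      - 2 * gsin κ (s + u) * gsin κ u * f1 - 2 * gsin κ (s + u) * gsin κ s * f2
      + 2 * gsin κ u * gsin κ s * f3 - 2 * hs - hS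
  · have hs := gsin_add κ s u
    unfold form at *
    rw [hvx, hvy, hvz]
    linear_combination gsin κ (s + u) * n3 - gsin κ u * f1 - gsin κ s * f2 + hs
  · rintro rfl
    obtain ⟨e1, e2, e3⟩ := d0 rfl
    simp only [gsin_curv_zero] at hvx hvy
    rw [hvx, hvy]
    linear_combination ((s + u) * u) * e1 + ((s + u) * s) * e2 - s * u * e3

/-- Stewart's theorem. -/
theorem stewart_eq {p q : ModelPlane κ} {γ : ℝ → ModelPlane κ} (hγ : IsGeodesicFromTo γ p q)
    {s : ℝ} (hs : s ∈ Icc 0 (dist p q)) (a : ModelPlane κ) :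
    gsin κ (dist p q) * gver κ (dist a (γ s)) =
      stewartBound κ (dist p q) s (dist a p) (dist a q) := by
  have hℓ : 0 ≤ dist p q := hs.1.trans hs.2
  have h1 : dist p (γ s) = s := by
    have := hγ.dist_eq 0 ⟨le_rfl, hℓ⟩ s hs
    rwa [hγ.source, zero_sub, abs_neg, abs_of_nonneg hs.1] at this
  have h2 : dist (γ s) q = dist p q - s := by
    have := hγ.dist_eq s hs _ ⟨hℓ, le_rfl⟩
    rwa [hγ.target, abs_sub_comm, abs_of_nonneg (sub_nonneg.2 hs.2)] at this
  obtain ⟨ex, ey, ez⟩ := combination_of_dist h1 h2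
  rcases eq_or_ne κ 0 with rfl | hκ
  · have e1 := sq_dist_zero p (γ s)
    have e2 := sq_dist_zero (γ s) q
    have e3 := sq_dist_zero p q
    rw [h1] at e1
    rw [h2] at e2
    simp only [stewartBound, gsin_curv_zero, gver_curv_zero, sq_dist_zero] at *
    generalize dist p q = ℓ at *
    linear_combination (-(a.x - (γ s).x)) * ex - (a.y - (γ s).y) * ey
      + (ℓ - s) / 2 * e1 + s / 2 * e2
  · have e := gsin_sub_mul_stewartBound κ (dist p q) s (dist a p) (dist a q)
    have f1 := form_eq_gcos_dist a (γ s)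
    rw [gcos_eq_gver] at f1
    rw [← form_eq_gcos_dist, ← form_eq_gcos_dist] at e
    apply mul_left_cancel₀ hκ
    unfold form at *
    linear_combination e + gsin κ (dist p q) * f1 - κ * a.x * ex - κ * a.y * ey - a.z * ez

theorem exists_combination {p q : ModelPlane κ} (h0 : 0 < dist p q)
    (hκ : LTDivSqrt κ (dist p q) Real.pi) {s : ℝ} (hs : s ∈ Icc 0 (dist p q)) :
    ∃ g : ModelPlane κ,
      gsin κ (dist p q) * g.x = gsin κ (dist p q - s) * p.x + gsin κ s * q.x ∧
      gsin κ (dist p q) * g.y = gsin κ (dist p q - s) * p.y + gsin κ s * q.y ∧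
      gsin κ (dist p q) * g.z = gsin κ (dist p q - s) * p.z + gsin κ s * q.z := by
  have hS := gsin_pos h0 hκ
  have h1 : 0 ≤ gsin κ s := gsin_nonneg hs.1 (hκ.le.mono hs.2)
  have h2 : 0 ≤ gsin κ (dist p q - s) :=
    gsin_nonneg (by linarith [hs.2]) (hκ.le.mono (by linarith [hs.1]))
  have f := form_eq_gcos_dist p q
  have n1 := p.eqn
  have n2 := q.eqn
  have hsq := gsin_add_sq κ s (dist p q - s)
  have hadd := gsin_add κ s (dist p q - s)
  rw [add_sub_cancel] at hsq hadd
  refine ⟨⟨(gsin κ (dist p q - s) * p.x + gsin κ s * q.x) / gsin κ (dist p q),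
    (gsin κ (dist p q - s) * p.y + gsin κ s * q.y) / gsin κ (dist p q),
    (gsin κ (dist p q - s) * p.z + gsin κ s * q.z) / gsin κ (dist p q), ?_, ?_⟩, ?_, ?_, ?_⟩
  · field_simp
    unfold form at f
    linear_combination gsin κ (dist p q - s) ^ 2 * n1 + gsin κ s ^ 2 * n2
      + 2 * gsin κ (dist p q - s) * gsin κ s * f - hsq
  · intro hκ0
    refine div_pos ?_ hS
    have p1 := p.pos hκ0
    have p2 := q.pos hκ0
    have hne : 0 < gsin κ (dist p q - s) + gsin κ s := by
      rcases h1.eq_or_lt with h | h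
      · rw [← h] at hadd ⊢
        rcases h2.eq_or_lt with h' | h'
        · rw [← h'] at hadd; simp at hadd; exact absurd hadd hS.ne'
        · linarith
      · linarith
    rcases h1.eq_or_lt with h | h
    · have : 0 < gsin κ (dist p q - s) := by linarith
      positivity
    · positivity
  all_goals simp only; field_simp

theorem exists_geodesic {p q : ModelPlane κ} (hκ : LTDivSqrt κ (dist p q) Real.pi) :
    ∃ γ, IsGeodesicFromTo γ p q := by
  have hself : ∀ a : ModelPlane κ, dist a a = 0 := fun a =>
    dist_eq_of_form le_rfl (fun h => by positivity) (by rw [form_self, gcos_zero])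
      (fun _ => by ring)
  rcases (dist_nonneg' p q).eq_or_lt with h0 | h0
  · have f := form_eq_gcos_dist p q
    rw [← h0, gcos_zero] at f
    have n1 := p.eqn
    have n2 := q.eqn
    unfold form at f
    obtain ⟨e1, e2, e3⟩ := eq_zero_of_null (vx := p.x - q.x) (vy := p.y - q.y) (vz := p.z - q.z) p
      (by linear_combination n1 + n2 - 2 * f) (by linear_combination n1 - f)
      (by rintro rfl; rw [← sq_dist_zero, ← h0]; ring)
    obtain rfl : p = q := ModelPlane.ext (by linarith) (by linarith) (by linarith)
    refine ⟨fun _ => p, rfl, rfl, fun s hs t ht => ?_⟩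
    rw [← h0] at hs ht
    rw [hself, le_antisymm hs.2 hs.1, le_antisymm ht.2 ht.1]; simp
  · have hex : ∀ s : ℝ, ∃ g : ModelPlane κ, s ∈ Icc 0 (dist p q) →
      (gsin κ (dist p q) * g.x = gsin κ (dist p q - s) * p.x + gsin κ s * q.x ∧
      gsin κ (dist p q) * g.y = gsin κ (dist p q - s) * p.y + gsin κ s * q.y ∧
      gsin κ (dist p q) * g.z = gsin κ (dist p q - s) * p.z + gsin κ s * q.z) := by
      intro s
      by_cases hs : s ∈ Icc 0 (dist p q)
      · obtain ⟨g, hg⟩ := exists_combination h0 hκ hs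
        exact ⟨g, fun _ => hg⟩
      · exact ⟨p, fun h => absurd h hs⟩
    choose γ hγ using hex
    have hS := gsin_pos h0 hκ
    have f := form_eq_gcos_dist p q
    have n1 := p.eqn
    have n2 := q.eqn
    refine ⟨γ, ?_, ?_, ?_⟩
    · obtain ⟨e1, e2, e3⟩ := hγ 0 ⟨le_rfl, h0.le⟩
      simp only [sub_zero, gsin_zero, zero_mul, add_zero] at e1 e2 e3
      exact ModelPlane.ext (mul_left_cancel₀ hS.ne' e1) (mul_left_cancel₀ hS.ne' e2)
        (mul_left_cancel₀ hS.ne' e3)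
    · obtain ⟨e1, e2, e3⟩ := hγ (dist p q) ⟨h0.le, le_rfl⟩
      simp only [sub_self, gsin_zero, zero_mul, zero_add] at e1 e2 e3
      exact ModelPlane.ext (mul_left_cancel₀ hS.ne' e1) (mul_left_cancel₀ hS.ne' e2)
        (mul_left_cancel₀ hS.ne' e3)
    · intro s hs t ht
      obtain ⟨e1, e2, e3⟩ := hγ s hs
      obtain ⟨e1', e2', e3'⟩ := hγ t ht
      refine dist_eq_of_form (abs_nonneg _) (hκ.le.mono ?_) ?_ ?_
      · rw [abs_le]; constructor <;> linarith [hs.1, hs.2, ht.1, ht.2]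
      · have hab : gcos κ |s - t| = gcos κ (s - t) := by
          rw [gcos_eq_gver, gver_abs, ← gcos_eq_gver]
        rw [hab]
        apply mul_left_cancel₀ (pow_ne_zero 2 hS.ne')
        have key : gsin κ (dist p q) ^ 2 * (γ s).form (γ t)
            = gsin κ (dist p q - s) * gsin κ (dist p q - t) + gsin κ s * gsin κ t
              + (gsin κ (dist p q - s) * gsin κ t + gsin κ s * gsin κ (dist p q - t))
                * gcos κ (dist p q) := by
          have : gsin κ (dist p q) ^ 2 * (γ s).form (γ t)
              = κ * ((gsin κ (dist p q) * (γ s).x) * (gsin κ (dist p q) * (γ t).x)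
                + (gsin κ (dist p q) * (γ s).y) * (gsin κ (dist p q) * (γ t).y))
                + (gsin κ (dist p q) * (γ s).z) * (gsin κ (dist p q) * (γ t).z) := by
            unfold form; ring
          rw [this, e1, e2, e3, e1', e2', e3', ← f]
          unfold form
          linear_combination (gsin κ (dist p q - s) * gsin κ (dist p q - t)) * n1
            + (gsin κ s * gsin κ t) * n2
        rw [key]
        have c1 := gcos_sq_add κ (dist p q)
        rw [gsin_sub, gsin_sub, gcos_sub]
        linear_combination (-(gsin κ s * gsin κ t)) * c1
      · rintro rfl
        simp only [gsin_curv_zero] at *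
        have d := sq_dist_zero p q
        rw [sq_abs]
        apply mul_left_cancel₀ (pow_ne_zero 2 hS.ne')
        have k1 : dist p q * ((γ s).x - (γ t).x) = (t - s) * (p.x - q.x) := by
          linear_combination e1 - e1'
        have k2 : dist p q * ((γ s).y - (γ t).y) = (t - s) * (p.y - q.y) := by
          linear_combination e2 - e2'
        have : dist p q ^ 2 * (((γ s).x - (γ t).x) ^ 2 + ((γ s).y - (γ t).y) ^ 2)
            = (dist p q * ((γ s).x - (γ t).x)) ^ 2 + (dist p q * ((γ s).y - (γ t).y)) ^ 2 := by
          ring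
        rw [this, k1, k2, d]; ring

end ModelPlane

/-! ### Comparison triangles -/

namespace ModelPlane

variable {κ : ℝ}

theorem gver_le_gver_add {a b c : ℝ} (ha : 0 ≤ a) (habc : a ≤ b + c)
    (hsum : LEDivSqrt κ (a + b + c) (2 * Real.pi)) :
    gver κ a ≤ gver κ (b + c) := by
  by_cases h : LEDivSqrt κ (b + c) Real.pi
  · exact gver_le_gver ha habc h
  · rw [LEDivSqrt] at h
    push Not at h
    obtain ⟨hκ, h⟩ := h
    have h1 := hsum hκ
    rw [mul_div_assoc] at h1
    have e : gver κ (b + c) = gver κ (2 * (Real.pi / √κ) - (b + c)) := by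
      have hs : √κ ≠ 0 := (Real.sqrt_pos.2 hκ).ne'
      have e1 := gcos_eq_gver κ (b + c)
      have e2 := gcos_eq_gver κ (2 * (Real.pi / √κ) - (b + c))
      rw [gcos, if_pos hκ] at e1 e2
      rw [show √κ * (2 * (Real.pi / √κ) - (b + c)) = 2 * Real.pi - √κ * (b + c) by field_simp,
        Real.cos_two_pi_sub] at e2
      exact mul_left_cancel₀ hκ.ne' (by linarith)
    rw [e]
    exact gver_le_gver ha (by linarith) fun _ => by linarith

/-- Triangles with prescribed side lengths exist, by the law of cosines. -/
theorem exists_triangle {a b c : ℝ} (ha : 0 ≤ a) (hb : 0 ≤ b) (hc : 0 ≤ c) (h1 : a ≤ b + c)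
    (h2 : b ≤ c + a) (h3 : c ≤ a + b) (haκ : LTDivSqrt κ a Real.pi) (hbκ : LTDivSqrt κ b Real.pi)
    (hcκ : LTDivSqrt κ c Real.pi) (hsum : LTDivSqrt κ (a + b + c) (2 * Real.pi)) :
    ∃ p q r : ModelPlane κ, dist q r = a ∧ dist r p = b ∧ dist p q = c := by
  have hz : ∀ x, LTDivSqrt κ x Real.pi → κ ≤ 0 → 0 < gcos κ x := fun x _ hκ =>
    gcos_pos fun h => absurd hκ (not_le.2 h)
  have hp : κ * ((0 : ℝ) ^ 2 + 0 ^ 2) + (1 : ℝ) ^ 2 = 1 := by ring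
  -- the first coordinate `u` of the third vertex, in polar coordinates about the first
  obtain ⟨u, v, huv, hu⟩ : ∃ u v : ℝ, u ^ 2 + v ^ 2 = gsin κ b ^ 2 ∧
      gsin κ c * u = gver κ b + gver κ c - κ * gver κ b * gver κ c - gver κ a := by
    rcases hc.eq_or_lt with rfl | hc0
    · obtain rfl : a = b := by linarith
      exact ⟨gsin κ a, 0, by ring, by simp⟩
    · have hs := gsin_pos hc0 hcκ
      have hsb := gsin_nonneg hb hbκ.le
      set W := gver κ b + gver κ c - κ * gver κ b * gver κ c - gver κ a with hW
      have e1 := gver_add κ b c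
      have e2 := gver_add κ b (-c)
      rw [gver_neg, gsin_neg, gcos_eq_gver] at e2
      rw [gcos_eq_gver] at e1
      have i1 := gver_le_gver_add ha h1 hsum.le
      have i2 : gver κ (b + -c) ≤ gver κ a := by
        rw [← gver_abs]
        refine gver_le_gver (abs_nonneg _) ?_ haκ.le
        rw [abs_le]; constructor <;> linarith
      have hWsq : W ^ 2 ≤ (gsin κ b * gsin κ c) ^ 2 :=
        sq_le_sq' (by rw [hW]; linarith) (by rw [hW]; linarith)
      refine ⟨W / gsin κ c, √(gsin κ b ^ 2 - (W / gsin κ c) ^ 2), ?_, by field_simp⟩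
      rw [Real.sq_sqrt]
      · ring
      · rw [sub_nonneg, div_pow, div_le_iff₀ (by positivity), ← mul_pow]; exact hWsq
  have hq : κ * (gsin κ c ^ 2 + 0 ^ 2) + gcos κ c ^ 2 = 1 := by linarith [gcos_sq_add κ c]
  have hr : κ * (u ^ 2 + v ^ 2) + gcos κ b ^ 2 = 1 := by rw [huv]; linarith [gcos_sq_add κ b]
  refine ⟨⟨0, 0, 1, hp, fun _ => one_pos⟩, ⟨gsin κ c, 0, gcos κ c, hq, hz c hcκ⟩,
    ⟨u, v, gcos κ b, hr, hz b hbκ⟩, ?_, ?_, ?_⟩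
  · refine dist_eq_of_form ha haκ.le ?_ ?_
    · simp only [form]
      rw [gcos_eq_gver κ a, gcos_eq_gver κ b, gcos_eq_gver κ c]
      linear_combination κ * hu
    · rintro rfl
      simp only [gsin_curv_zero, gver_curv_zero] at *
      linear_combination huv - 2 * hu
  · refine dist_eq_of_form hb hbκ.le (by simp [form]) ?_
    rintro rfl
    simp only [gsin_curv_zero] at huv
    simpa using huv
  · refine dist_eq_of_form hc hcκ.le (by simp [form]) ?_
    rintro rfl
    simp

end ModelPlane

section Triangles

variable {X : Type*} [MetricSpace X] {κ : ℝ}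

/-- The distances of corresponding points of a triangle and of a comparison triangle, if Stewart's
inequality holds in the space. -/
theorem SatisfiesStewart.dist_le_dist_comparison (hX : SatisfiesStewart κ X)
    (T : GeodesicTriangle X) (T' : GeodesicTriangle (ModelPlane κ)) (hT : T.IsComparison T')
    (hsize : ∀ x y : X, LTDivSqrt κ (dist x y) Real.pi) (i j : Fin 3) {s t : ℝ}
    (hs : s ∈ Icc 0 (T.edgeLength i)) (ht : t ∈ Icc 0 (T.edgeLength j)) :
    dist (T.edge i s) (T.edge j t) ≤ dist (T'.edge i s) (T'.edge j t) := by
  have hself : ∀ a : ModelPlane κ, dist a a = 0 := fun a =>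
    ModelPlane.dist_eq_of_form le_rfl (fun h => by positivity)
      (by rw [ModelPlane.form_self, gcos_zero]) (fun _ => by ring)
  have hv : ∀ a b, dist (T.vertex a) (T.vertex b) = dist (T'.vertex a) (T'.vertex b) := by
    have h : ∀ k, dist (T.vertex (k + 1)) (T.vertex (k + 2))
        = dist (T'.vertex (k + 1)) (T'.vertex (k + 2)) := fun k => (hT k).symm
    have h' : ∀ k, dist (T.vertex (k + 2)) (T.vertex (k + 1))
        = dist (T'.vertex (k + 2)) (T'.vertex (k + 1)) := fun k => by
      rw [dist_comm, h, ModelPlane.dist_comm']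
    intro a b
    fin_cases a <;> fin_cases b
    · simp [hself]
    · exact h 2
    · exact h' 1
    · exact h' 2
    · simp [hself]
    · exact h 0
    · exact h 1
    · exact h' 0
    · simp [hself]
  -- Stewart's inequality in the space and Stewart's theorem in the model
  have step : ∀ (k : Fin 3) (r : ℝ), r ∈ Icc 0 (T.edgeLength k) → ∀ (A : X) (A' : ModelPlane κ),
      (∀ a, dist A (T.vertex a) ≤ dist A' (T'.vertex a)) →
      dist A (T.edge k r) ≤ dist A' (T'.edge k r) := by
    intro k r hr A A' hA
    have e : T'.edgeLength k = T.edgeLength k := hT k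
    unfold GeodesicTriangle.edgeLength at e hr
    have h1 := hX A _ _ _ (T.isGeodesic k) r hr
    have h2 := ModelPlane.stewart_eq (T'.isGeodesic k) (by rwa [e]) A'
    rw [e] at h2
    rcases (dist_nonneg (x := T.vertex (k + 1)) (y := T.vertex (k + 2))).eq_or_lt with h0 | h0
    · have hr0 : r = 0 := le_antisymm (hr.2.trans h0.ge) hr.1
      rw [hr0, (T.isGeodesic k).source, (T'.isGeodesic k).source]
      exact hA _
    have h3 : Stewart κ (dist (T.vertex (k + 1)) (T.vertex (k + 2))) r
        (dist A' (T'.vertex (k + 1))) (dist A' (T'.vertex (k + 2))) (dist A (T.edge k r)) :=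
      h1.mono hr (hsize _ _).le dist_nonneg le_rfl (hsize _ _).le dist_nonneg (hA _)
        (ModelPlane.dist_leDivSqrt _ _) dist_nonneg (hA _) (ModelPlane.dist_leDivSqrt _ _)
    rw [Stewart, ← h2] at h3
    exact le_of_gver_le (ModelPlane.dist_nonneg' _ _) (hsize _ _).le
      (le_of_mul_le_mul_left h3 (gsin_pos h0 (hsize _ _)))
  refine step j t ht _ _ fun a => ?_
  rw [dist_comm, ModelPlane.dist_comm']
  exact step i s hs _ _ fun b => (hv a b).le

theorem LTDivSqrt.of_two_thirds {x : ℝ} (h : LTDivSqrt κ x (2 * Real.pi / 3)) :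
    LTDivSqrt κ x Real.pi := h.mono_right (by linarith [Real.pi_pos])

theorem perimeter_lt (hsize : ∀ x y : X, LTDivSqrt κ (dist x y) (2 * Real.pi / 3)) (A B C : X) :
    LTDivSqrt κ (dist B C + dist C A + dist A B) (2 * Real.pi) := by
  intro hκ
  have h1 := hsize B C hκ
  have h2 := hsize C A hκ
  have h3 := hsize A B hκ
  rw [div_right_comm] at h1 h2 h3
  linarith

theorem exists_comparison_points (hsize : ∀ x y : X, LTDivSqrt κ (dist x y) (2 * Real.pi / 3))
    (A B C : X) : ∃ p q r : ModelPlane κ, dist q r = dist B C ∧ dist r p = dist C A ∧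
      dist p q = dist A B := by
  refine ModelPlane.exists_triangle dist_nonneg dist_nonneg dist_nonneg ?_ ?_ ?_
    (hsize _ _).of_two_thirds (hsize _ _).of_two_thirds (hsize _ _).of_two_thirds
    (perimeter_lt hsize A B C)
  · linarith [dist_triangle B A C, dist_comm B A, dist_comm A C]
  · linarith [dist_triangle C B A, dist_comm C B, dist_comm B A]
  · linarith [dist_triangle A C B, dist_comm A C, dist_comm C B]

theorem exists_comparison_triangle
    (hsize : ∀ x y : X, LTDivSqrt κ (dist x y) (2 * Real.pi / 3)) (T : GeodesicTriangle X) :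
    ∃ T' : GeodesicTriangle (ModelPlane κ), T.IsComparison T' := by
  obtain ⟨p, q, r, h0, h1, h2⟩ := exists_comparison_points hsize (T.vertex 0) (T.vertex 1)
    (T.vertex 2)
  have hlen : ∀ i : Fin 3, dist ((![p, q, r] : Fin 3 → ModelPlane κ) (i + 1))
      ((![p, q, r] : Fin 3 → ModelPlane κ) (i + 2)) = T.edgeLength i := by
    intro i
    fin_cases i
    exacts [h0, h1, h2]
  have hex : ∀ i : Fin 3, ∃ γ, IsGeodesicFromTo γ
      ((![p, q, r] : Fin 3 → ModelPlane κ) (i + 1)) ((![p, q, r] : Fin 3 → ModelPlane κ) (i + 2)) :=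
    fun i => ModelPlane.exists_geodesic (by rw [hlen i]; exact (hsize _ _).of_two_thirds)
  choose γ hγ using hex
  exact ⟨⟨_, γ, hγ⟩, hlen⟩

theorem SatisfiesStewart.satisfiesCAT (hX : SatisfiesStewart κ X)
    (hsize : ∀ x y : X, LTDivSqrt κ (dist x y) (2 * Real.pi / 3)) (T : GeodesicTriangle X) :
    T.SatisfiesCAT κ := by
  refine ⟨?_, ?_⟩
  · rw [GeodesicTriangle.perimeter, Fin.sum_univ_three]
    exact perimeter_lt hsize (T.vertex 0) (T.vertex 1) (T.vertex 2)
  · obtain ⟨T', hT⟩ := exists_comparison_triangle hsize T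
    exact ⟨T', hT, fun i j s hs t ht => hX.dist_le_dist_comparison T T' hT
      (fun x y => (hsize x y).of_two_thirds) i j hs ht⟩

theorem IsCATSpace.satisfiesStewart (hX : IsCATSpace κ X)
    (hsize : ∀ x y : X, LTDivSqrt κ (dist x y) (2 * Real.pi / 3)) : SatisfiesStewart κ X := by
  intro A x y γ hγ s hs
  obtain ⟨α, hα⟩ := hX.1 y A
  obtain ⟨β, hβ⟩ := hX.1 A x
  let T : GeodesicTriangle X := ⟨![A, x, y], ![γ, α, β], fun i => by
    fin_cases i
    · exact hγ
    · exact hα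
    · exact hβ⟩
  have hper : LTDivSqrt κ T.perimeter (2 * Real.pi) := by
    rw [GeodesicTriangle.perimeter, Fin.sum_univ_three]
    intro hκ
    have h1 := hsize x y hκ
    have h2 := hsize y A hκ
    have h3 := hsize A x hκ
    rw [div_right_comm] at h1 h2 h3
    change dist x y + dist y A + dist A x < _
    linarith
  obtain ⟨-, T', hT, hle⟩ := hX.2 T hper
  have e0 : dist (T'.vertex 1) (T'.vertex 2) = dist x y := hT 0
  have e1 : dist (T'.vertex 2) (T'.vertex 0) = dist y A := hT 1
  have e2 : dist (T'.vertex 0) (T'.vertex 1) = dist A x := hT 2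
  have h := hle 0 1 s hs (dist y A) ⟨dist_nonneg, le_rfl⟩
  have h1 : T.edge 1 (dist y A) = A := hα.target
  have h2 : T'.edge 1 (dist y A) = T'.vertex 0 := by
    have := (T'.isGeodesic 1).target
    change T'.edge 1 (dist (T'.vertex 2) (T'.vertex 0)) = T'.vertex 0 at this
    rwa [e1] at this
  rw [h1, h2] at h
  change dist (γ s) A ≤ _ at h
  have h3 := ModelPlane.stewart_eq (T'.isGeodesic 0) (s := s) (by
    change s ∈ Icc 0 (dist (T'.vertex 1) (T'.vertex 2)); rwa [e0]) (T'.vertex 0)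
  change gsin κ (dist (T'.vertex 1) (T'.vertex 2)) * gver κ (dist (T'.vertex 0) (T'.edge 0 s)) =
    stewartBound κ (dist (T'.vertex 1) (T'.vertex 2)) s (dist (T'.vertex 0) (T'.vertex 1))
      (dist (T'.vertex 0) (T'.vertex 2)) at h3
  rw [e0, e2, ModelPlane.dist_comm' (T'.vertex 0) (T'.vertex 2), e1, dist_comm y A] at h3
  rw [Stewart, ← h3, ModelPlane.dist_comm' (T'.vertex 0), dist_comm A]
  exact mul_le_mul_of_nonneg_left (gver_le_gver dist_nonneg h (ModelPlane.dist_leDivSqrt _ _))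
    (gsin_nonneg dist_nonneg (hsize _ _).of_two_thirds.le)

end Triangles

/-! ### Simple branched covers -/

section Paths

variable {Y : Type*} [MetricSpace Y]

theorem edist_add_edist_le_eVariationOn {f : unitInterval → Y} (s : unitInterval) :
    edist (f 0) (f s) + edist (f s) (f 1) ≤ eVariationOn f univ := by
  have h := eVariationOn.Icc_add_Icc f (s := univ) unitInterval.nonneg' unitInterval.le_one'
    (mem_univ s)
  simp only [univ_inter] at h
  calc edist (f 0) (f s) + edist (f s) (f 1)
      ≤ eVariationOn f (Icc 0 s) + eVariationOn f (Icc s 1) :=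
        add_le_add
          (eVariationOn.edist_le f ⟨le_rfl, unitInterval.nonneg'⟩ ⟨unitInterval.nonneg', le_rfl⟩)
          (eVariationOn.edist_le f ⟨le_rfl, unitInterval.le_one'⟩ ⟨unitInterval.le_one', le_rfl⟩)
    _ = eVariationOn f (Icc 0 1) := h
    _ ≤ eVariationOn f univ := eVariationOn.mono f (subset_univ _)

end Paths

namespace IsSimpleBranchedCover

variable {X Y : Type*} [MetricSpace X] [MetricSpace Y] {Δ : Set X} {π : Y → X}

theorem exists_path (hπ : IsSimpleBranchedCover π Δ) (y z : Y) {ε : ℝ} (hε : 0 < ε) :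
    ∃ c : Path y z, (∀ s, dist y (c s) + dist (c s) z < dist y z + ε) ∧
      ((∀ s, π (c s) ∉ Δ) → dist (π y) (π z) < dist y z + ε) := by
  obtain ⟨c, hc⟩ := hπ.isPathLengthSpace y z ε hε
  refine ⟨c, fun s => ?_, fun hmiss => ?_⟩
  · have h := (edist_add_edist_le_eVariationOn (f := c) s).trans_lt hc
    rw [c.source, c.target, edist_dist, edist_dist, ← ENNReal.ofReal_add dist_nonneg dist_nonneg]
      at h
    exact (ENNReal.ofReal_lt_ofReal_iff_of_nonneg (by positivity)).1 h
  · have hU : ∀ s : unitInterval, ∃ U : Set Y, IsOpen U ∧ c s ∈ U ∧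
        ∀ a ∈ U, ∀ b ∈ U, dist (π a) (π b) = dist a b := fun s => by
      obtain ⟨U, hU, hiso⟩ := hπ.locally_isometric (c s) (hmiss s)
      obtain ⟨V, hVU, hV, hs⟩ := mem_nhds_iff.1 hU
      exact ⟨V, hV, hs, fun a ha b hb => hiso a (hVU ha) b (hVU hb)⟩
    choose U hUo hUs hUiso using hU
    obtain ⟨t, ht0, htm, ⟨n, hn⟩, htU⟩ := exists_monotone_Icc_subset_open_cover_unitInterval
      (c := fun s => c ⁻¹' U s) (fun s => (hUo s).preimage c.continuous)
      (fun s _ => mem_iUnion.2 ⟨s, hUs s⟩)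
    have hstep : ∀ i,
        edist (π (c (t i))) (π (c (t (i + 1)))) = edist (c (t (i + 1))) (c (t i)) := by
      intro i
      obtain ⟨s, hs⟩ := htU i
      rw [edist_comm (c (t (i + 1))), edist_dist, edist_dist, hUiso s _
        (hs ⟨le_rfl, htm (Nat.le_succ i)⟩) _ (hs ⟨htm (Nat.le_succ i), le_rfl⟩)]
    have h1 := edist_le_range_sum_edist (fun i => π (c (t i))) n
    simp only [hstep] at h1
    have h2 := eVariationOn.sum_le (f := c) (s := univ) (n := n) (u := t) htm
      (fun _ => mem_univ _)
    have h3 := (h1.trans h2).trans_lt hc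
    rw [ht0, hn n le_rfl, c.source, c.target, edist_dist] at h3
    exact (ENNReal.ofReal_lt_ofReal_iff_of_nonneg dist_nonneg).1 h3

/-- The map of a simple branched cover is distance-nonincreasing. -/
theorem dist_map_le (hπ : IsSimpleBranchedCover π Δ) (y z : Y) :
    dist (π y) (π z) ≤ dist y z := by
  refine le_of_forall_pos_lt_add fun ε hε => ?_
  obtain ⟨c, hc, hmiss⟩ := hπ.exists_path y z hε
  by_cases h : ∃ s, π (c s) ∈ Δ
  · obtain ⟨s, hs⟩ := h
    have h1 := hc s
    rw [hπ.dist_eq _ _ (Or.inr hs), hπ.dist_eq _ _ (Or.inl hs)] at h1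
    exact (dist_triangle _ _ _).trans_lt h1
  · exact hmiss (not_exists.1 h)

theorem continuous (hπ : IsSimpleBranchedCover π Δ) : Continuous π :=
  (LipschitzWith.of_dist_le_mul (K := 1) fun y z => by simpa using hπ.dist_map_le y z).continuous

theorem exists_mem_fibre (hπ : IsSimpleBranchedCover π Δ) {w : X} (hw : w ∈ Δ) :
    ∃ y, π y = w := hπ.surjOn hw

theorem eq_of_map_eq (hπ : IsSimpleBranchedCover π Δ) {y z : Y} (hy : π y ∈ Δ) (h : π y = π z) :
    y = z := by
  rw [← dist_eq_zero, hπ.dist_eq y z (Or.inl hy), h, dist_self]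

theorem dist_le_of_mem (hπ : IsSimpleBranchedCover π Δ) {w : X} (hw : w ∈ Δ) (y z : Y) :
    dist y z ≤ dist (π y) w + dist w (π z) := by
  obtain ⟨v, rfl⟩ := hπ.exists_mem_fibre hw
  rw [← hπ.dist_eq y v (Or.inr hw), ← hπ.dist_eq v z (Or.inl hw)]
  exact dist_triangle _ _ _

/-- A lift of a geodesic that avoids the branch locus is a geodesic. -/
theorem isGeodesicOn_of_comp (hπ : IsSimpleBranchedCover π Δ) {σ : ℝ → Y} {a b : ℝ}
    (hσ : ContinuousOn σ (Icc a b)) (hgeo : IsGeodesicOn (π ∘ σ) a b)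
    (hmiss : ∀ t ∈ Icc a b, π (σ t) ∉ Δ) : IsGeodesicOn σ a b := by
  have key : ∀ u v, a ≤ u → u ≤ v → v ≤ b → dist (σ u) (σ v) ≤ v - u := by
    intro u v hau huv hvb
    have hσ' : ContinuousOn σ (Icc u v) := hσ.mono (Icc_subset_Icc hau hvb)
    have hsub : Icc u v ⊆ {t | dist (σ u) (σ t) ≤ t - u} := by
      refine IsClosed.Icc_subset_of_forall_exists_gt ?_ (by simp) ?_
      · have hc : ContinuousOn (fun t => dist (σ u) (σ t) - (t - u)) (Icc u v) :=
          ((continuous_const.dist continuous_id).comp_continuousOn hσ').sub (by fun_prop)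
        have := hc.preimage_isClosed_of_isClosed isClosed_Icc (isClosed_Iic (a := (0 : ℝ)))
        convert this using 1
        ext t
        simp only [mem_inter_iff, mem_ofPred_eq, mem_preimage, mem_Iic, sub_nonpos, and_comm]
      · rintro t ⟨ht, htu, htv⟩ z hz
        obtain ⟨U, hU, hiso⟩ := hπ.locally_isometric (σ t) (hmiss t ⟨by linarith, by linarith⟩)
        have h1 : ∀ᶠ t' in 𝓝[Icc u v] t, σ t' ∈ U := (hσ' t ⟨htu, htv.le⟩) hU
        have h2 : ∀ᶠ t' in 𝓝[>] t, σ t' ∈ U := by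
          have : 𝓝[>] t ≤ 𝓝[Icc u v] t := by
            rw [← nhdsWithin_Ioo_eq_nhdsGT htv]
            exact nhdsWithin_mono _ fun r hr => ⟨htu.trans hr.1.le, hr.2.le⟩
          exact this h1
        obtain ⟨t', ht', ⟨htt', htz⟩⟩ := (h2.and (Ioc_mem_nhdsGT (lt_min hz htv))).exists
        refine ⟨t', ?_, htt', htz.trans (min_le_left _ _)⟩
        have hv' := htz.trans (min_le_right _ _)
        have h3 := hiso _ (mem_of_mem_nhds hU) _ ht'
        have h4 := hgeo.dist_eq (hau.trans htu) htt'.le (hv'.trans hvb)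
        simp only [Function.comp_apply] at h4
        have h5 := dist_triangle (σ u) (σ t) (σ t')
        simp only [mem_ofPred_eq] at ht ⊢
        linarith
    exact hsub ⟨huv, le_rfl⟩
  have key' : ∀ u v, a ≤ u → u ≤ v → v ≤ b → dist (σ u) (σ v) = |u - v| := by
    intro u v hau huv hvb
    rw [abs_sub_comm, abs_of_nonneg (sub_nonneg.2 huv)]
    refine le_antisymm (key u v hau huv hvb) ?_
    rw [← hgeo.dist_eq hau huv hvb]
    exact hπ.dist_map_le _ _
  intro s hs t ht
  rcases le_total s t with h | h
  · exact key' s t hs.1 h ht.2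
  · rw [dist_comm, abs_sub_comm]; exact key' t s ht.1 h hs.2

/-- Lifts that avoid the branch locus are determined by one value. -/
theorem lift_unique (hπ : IsSimpleBranchedCover π Δ) {A : Type*} [TopologicalSpace A]
    [PreconnectedSpace A] {f g : A → Y} (hf : Continuous f) (hg : Continuous g)
    (h : ∀ a, π (f a) = π (g a)) (hmiss : ∀ a, π (f a) ∉ Δ) {a : A} (ha : f a = g a) : f = g := by
  have hmiss' : ∀ a, π (g a) ∉ Δ := fun a => h a ▸ hmiss a
  have := hπ.isCoveringMap.eq_of_comp_eq (g₁ := fun a => ⟨f a, hmiss a⟩)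
    (g₂ := fun a => ⟨g a, hmiss' a⟩) (hf.subtype_mk _) (hg.subtype_mk _)
    (funext fun a => Subtype.ext (h a)) a (Subtype.ext ha)
  funext b
  exact congrArg Subtype.val (congrFun this b)

/-- Families of paths with a common initial point lift. -/
theorem exists_lift (hπ : IsSimpleBranchedCover π Δ) {A : Type*} [TopologicalSpace A]
    {H : unitInterval × A → X} (hH : Continuous H) (hmiss : ∀ p, H p ∉ Δ) {y : Y}
    (h0 : ∀ a, H (0, a) = π y) (hy : π y ∉ Δ) :
    ∃ L : unitInterval × A → Y, Continuous L ∧ (∀ p, π (L p) = H p) ∧ ∀ a, L (0, a) = y := by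
  let H' : C(unitInterval × A, (Δᶜ : Set X)) := ⟨fun p => ⟨H p, hmiss p⟩, hH.subtype_mk _⟩
  let f : C(A, π ⁻¹' Δᶜ) := ContinuousMap.const A ⟨y, hy⟩
  have hf : ∀ a, H' (0, a) = Δᶜ.restrictPreimage π (f a) := fun a => Subtype.ext (h0 a)
  refine ⟨fun p => (hπ.isCoveringMap.liftHomotopy H' f hf p).1,
    continuous_subtype_val.comp (ContinuousMap.continuous _), fun p => ?_, fun a => ?_⟩
  · exact congrArg Subtype.val (congrFun (hπ.isCoveringMap.liftHomotopy_lifts H' f hf) p)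
  · exact congrArg Subtype.val (hπ.isCoveringMap.liftHomotopy_zero H' f hf a)

variable {κ : ℝ}

/-- Either two points of the branched cover are joined by a lift of a geodesic, or their distance is
attained, up to any positive error, by going through the branch locus. -/
theorem exists_geodesic_or (hπ : IsSimpleBranchedCover π Δ) (hX : SatisfiesStewart κ X)
    (hgeo : IsGeodesicSpace X) (hsize : ∀ x y : X, LTDivSqrt κ (dist x y) Real.pi) (A P : Y) :
    (dist A P = dist (π A) (π P) ∧ ∃ σ : ℝ → Y, IsGeodesicFromTo σ A P) ∨
      ∀ ε, 0 < ε → ∃ w ∈ Δ, dist (π A) w + dist w (π P) < dist A P + ε := by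
  refine or_iff_not_imp_right.2 fun hno => ?_
  push Not at hno
  obtain ⟨ε, hε, hw⟩ := hno
  obtain ⟨c, hc, -⟩ := hπ.exists_path A P hε
  choose g hg using hgeo (π A)
  -- the geodesics from `π A` to the points of the projected path all avoid the branch locus
  set H : unitInterval × unitInterval → X :=
    fun p => g (π (c p.2)) (p.1 * dist (π A) (π (c p.2))) with hH
  have hHc : Continuous H :=
    (hX.continuous_geodesic hsize (π A) hg).comp
      (g := fun p : unitInterval × X => g p.2 (p.1 * dist (π A) p.2))
      (f := fun p : unitInterval × unitInterval => (p.1, π (c p.2)))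
      (continuous_fst.prodMk (hπ.continuous.comp (c.continuous.comp continuous_snd)))
  have hmem : ∀ p : unitInterval × unitInterval,
      (p.1 : ℝ) * dist (π A) (π (c p.2)) ∈ Icc 0 (dist (π A) (π (c p.2))) := fun p =>
    ⟨mul_nonneg p.1.2.1 dist_nonneg, mul_le_of_le_one_left dist_nonneg p.1.2.2⟩
  have hmiss : ∀ p, H p ∉ Δ := by
    intro p hp
    have h1 := hw _ hp
    have h2 := (hg (π (c p.2))).dist_left (hmem p)
    have h3 := (hg (π (c p.2))).dist_right (hmem p)
    have h4 := dist_triangle (H p) (π (c p.2)) (π P)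
    have h5 := hπ.dist_map_le A (c p.2)
    have h6 := hπ.dist_map_le (c p.2) P
    have h7 := hc p.2
    simp only [hH] at h1 h4
    linarith
  have hstart : ∀ s, H (0, s) = π A := fun s => by simp [hH, (hg _).source]
  have hend : ∀ s, H (1, s) = π (c s) := fun s => by simp [hH, (hg _).target]
  have hA : π A ∉ Δ := hstart 0 ▸ hmiss (0, 0)
  obtain ⟨L, hL, hLH, hL0⟩ := hπ.exists_lift hHc hmiss hstart hA
  have hconst : ∀ s, dist (π A) (π (c s)) = 0 → ∀ t, L (t, s) = A := by
    intro s hs t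
    have h1 : ∀ t, H (t, s) = π A := fun t => by
      simp only [hH, hs, mul_zero]; rw [(hg _).source]
    have := hπ.lift_unique (f := fun t => L (t, s)) (g := fun _ => A) (by fun_prop)
      continuous_const (fun t => by rw [hLH, h1]) (fun t => by rw [hLH]; exact hmiss _)
      (a := 0) (hL0 s)
    exact congrFun this t
  have hLc : (fun s => L (1, s)) = c := by
    refine hπ.lift_unique (by fun_prop) c.continuous (fun s => by rw [hLH, hend])
      (fun s => by rw [hLH]; exact hmiss _) (a := 0) ?_
    rw [c.source]
    exact hconst 0 (by rw [c.source, dist_self]) 1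
  have hLP : L (1, 1) = P := by rw [← c.target, ← hLc]
  rcases (dist_nonneg (x := π A) (y := π P)).eq_or_lt with h0 | h0
  · obtain rfl : A = P := by
      rw [← hLP]; exact (hconst 1 (by rw [c.target]; exact h0.symm) 1).symm
    exact ⟨by simp, fun _ => A, rfl, rfl, fun s hs t ht => by
      rw [dist_self] at hs ht ⊢
      rw [le_antisymm hs.2 hs.1, le_antisymm ht.2 ht.1]; simp⟩
  set ℓ := dist (π A) (π P) with hℓ
  let σ : ℝ → Y := fun t => L (projIcc 0 1 zero_le_one (t / ℓ), 1)
  have hσπ : ∀ t ∈ Icc 0 ℓ, π (σ t) = g (π P) t := by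
    intro t ht
    have h1 : t / ℓ ∈ Icc (0 : ℝ) 1 :=
      ⟨div_nonneg ht.1 h0.le, (div_le_one h0).2 ht.2⟩
    simp only [σ, hLH, projIcc_of_mem zero_le_one h1, hH, c.target]
    rw [← hℓ, div_mul_cancel₀ _ h0.ne']
  have hσ : IsGeodesicOn σ 0 ℓ := by
    refine hπ.isGeodesicOn_of_comp ?_ ?_ ?_
    · refine (hL.comp ?_).continuousOn
      exact (continuous_projIcc.comp (continuous_id.div_const ℓ)).prodMk continuous_const
    · intro s hs t ht
      rw [Function.comp, Function.comp, hσπ s hs, hσπ t ht]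
      exact (hg (π P)).dist_eq s hs t ht
    · intro t _
      rw [hLH]; exact hmiss _
  have e0 : σ 0 = A := by
    simp only [σ, zero_div]; rw [projIcc_left]; exact hL0 1
  have e1 : σ ℓ = P := by
    simp only [σ, div_self h0.ne']; rw [projIcc_right]; exact hLP
  have hd : dist A P = ℓ := by
    have := hσ.dist_eq le_rfl h0.le le_rfl
    rwa [e0, e1, sub_zero] at this
  exact ⟨hd, σ, e0, by rw [hd, e1], by rw [hd]; exact hσ⟩

/-- Every point is joined to every point over the branch locus by a geodesic. -/
theorem exists_geodesic_of_mem (hπ : IsSimpleBranchedCover π Δ) (hgeo : IsGeodesicSpace X)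
    (hΔ : IsClosed Δ) (hconv : IsGeodesicallyConvex Δ) (A : Y) {w : Y} (hw : π w ∈ Δ) :
    ∃ σ : ℝ → Y, IsGeodesicFromTo σ A w := by
  obtain ⟨p, hp⟩ := hgeo (π A) (π w)
  set ℓ := dist (π A) (π w) with hℓ
  have hd : dist A w = ℓ := hπ.dist_eq A w (Or.inr hw)
  have hℓ0 : 0 ≤ ℓ := dist_nonneg
  have hpc := hp.isGeodesicOn.continuousOn
  -- the first time at which the geodesic of `X` meets the branch locus
  obtain ⟨t₁, ⟨⟨ht₁0, ht₁ℓ⟩, ht₁Δ⟩, hleast⟩ :=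
    (isCompact_Icc.of_isClosed_subset (hpc.preimage_isClosed_of_isClosed isClosed_Icc hΔ)
      inter_subset_left).exists_isLeast ⟨ℓ, ⟨hℓ0, le_rfl⟩, by
        rw [mem_preimage, hp.target]; exact hw⟩
  have hafter : ∀ t ∈ Icc t₁ ℓ, p t ∈ Δ := by
    intro t ht
    have h1 := (hp.isGeodesicOn.mono ht₁0 le_rfl).isGeodesicFromTo ht₁ℓ
    have h2 : dist (p t₁) (p ℓ) = ℓ - t₁ := hp.isGeodesicOn.dist_eq ht₁0 ht₁ℓ le_rfl
    have h3 := (hconv (p t₁) ht₁Δ (p ℓ) (by rw [hp.target]; exact hw)).2 _ h1 (t - t₁)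
      (by rw [h2]; exact ⟨by linarith [ht.1], by linarith [ht.2]⟩)
    simpa using h3
  have hbefore : ∀ t ∈ Ico 0 t₁, p t ∉ Δ := fun t ht htΔ =>
    absurd (hleast ⟨⟨ht.1, ht.2.le.trans ht₁ℓ⟩, htΔ⟩) (not_le.2 ht.2)
  obtain ⟨j, hj⟩ : ∃ j : X → Y, ∀ v ∈ Δ, π (j v) = v := by
    have : ∀ v, ∃ y, v ∈ Δ → π y = v := fun v => by
      by_cases hv : v ∈ Δ
      · obtain ⟨y, hy⟩ := hπ.exists_mem_fibre hv
        exact ⟨y, fun _ => hy⟩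
      · exact ⟨w, fun h => absurd h hv⟩
    choose j hj using this
    exact ⟨j, hj⟩
  suffices h : ∃ σ : ℝ → Y, σ 0 = A ∧ (∀ t ∈ Icc 0 ℓ, π (σ t) = p t) ∧
      ∀ b < t₁, IsGeodesicOn σ 0 b by
    obtain ⟨σ, h0, hσp, hσ⟩ := h
    refine ⟨σ, h0, ?_, ?_⟩
    · rw [hd]
      have h1 : π (σ ℓ) = π w := by rw [hσp ℓ ⟨hℓ0, le_rfl⟩, hp.target]
      exact hπ.eq_of_map_eq (h1 ▸ hw) h1
    · rw [hd]
      intro s hs t ht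
      by_cases h : s < t₁ ∧ t < t₁
      · exact hσ _ (max_lt h.1 h.2) s ⟨hs.1, le_max_left _ _⟩ t ⟨ht.1, le_max_right _ _⟩
      · rw [hπ.dist_eq (σ s) (σ t), hσp s hs, hσp t ht]
        · exact hp.dist_eq s hs t ht
        · rw [hσp s hs, hσp t ht]
          rw [not_and_or, not_lt, not_lt] at h
          exact h.imp (fun h => hafter s ⟨h, hs.2⟩) fun h => hafter t ⟨h, ht.2⟩
  rcases ht₁0.eq_or_lt with rfl | hpos
  · refine ⟨fun t => j (p t), ?_, fun t ht => hj _ (hafter t ht), fun b hb s hs => ?_⟩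
    · have h1 := hj _ ht₁Δ
      refine hπ.eq_of_map_eq (by rw [h1]; exact ht₁Δ) ?_
      rw [h1, hp.source]
    · exact absurd (hs.1.trans hs.2) (not_le.2 hb)
  have hmem : ∀ q : unitInterval × Ico 0 t₁, (q.1 : ℝ) * q.2 ∈ Ico 0 t₁ := fun q =>
    ⟨mul_nonneg q.1.2.1 q.2.2.1,
      (mul_le_of_le_one_left q.2.2.1 q.1.2.2).trans_lt q.2.2.2⟩
  have hmiss : ∀ q : unitInterval × Ico 0 t₁, p (q.1 * q.2) ∉ Δ := fun q => hbefore _ (hmem q)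
  have hHc : Continuous fun q : unitInterval × Ico 0 t₁ => p (q.1 * q.2) :=
    hpc.comp_continuous (by fun_prop) fun q => ⟨(hmem q).1, (hmem q).2.le.trans ht₁ℓ⟩
  have hA : π A ∉ Δ := hp.source ▸ hbefore 0 ⟨le_rfl, hpos⟩
  obtain ⟨L, hL, hLH, hL0⟩ := hπ.exists_lift hHc hmiss (y := A)
    (fun a => by simp [hp.source]) hA
  have hcl : ∀ b < t₁, ∀ t : ℝ, max 0 (min t b) ∈ Ico 0 t₁ := fun b hb t =>
    ⟨le_max_left _ _, max_lt hpos ((min_le_right _ _).trans_lt hb)⟩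
  classical
  refine ⟨fun t => if h : t ∈ Ico 0 t₁ then L (1, ⟨t, h⟩) else j (p t), ?_, ?_, ?_⟩
  · have h0 : (0 : ℝ) ∈ Ico 0 t₁ := ⟨le_rfl, hpos⟩
    simp only [dif_pos h0]
    have := hπ.lift_unique (f := fun t => L (t, ⟨0, h0⟩)) (g := fun _ => A) (by fun_prop)
      continuous_const (fun t => by rw [hLH]; simp [hp.source])
      (fun t => by rw [hLH]; exact hmiss _) (a := 0) (hL0 _)
    exact congrFun this 1
  · intro t ht
    by_cases h : t ∈ Ico 0 t₁
    · simp only [dif_pos h, hLH]; simp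
    · simp only [dif_neg h]
      exact hj _ (hafter t ⟨not_lt.1 fun h' => h ⟨ht.1, h'⟩, ht.2⟩)
  · intro b hb
    have heq : EqOn (fun t => if h : t ∈ Ico 0 t₁ then L (1, ⟨t, h⟩) else j (p t))
        (fun t => L (1, ⟨max 0 (min t b), hcl b hb t⟩)) (Icc 0 b) := by
      intro t ht
      have h : t ∈ Ico 0 t₁ := ⟨ht.1, ht.2.trans_lt hb⟩
      simp only [dif_pos h, min_eq_left ht.2, max_eq_right ht.1]
    have hproj : ∀ t ∈ Icc 0 b,
        π (if h : t ∈ Ico 0 t₁ then L (1, ⟨t, h⟩) else j (p t)) = p t := by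
      intro t ht
      have h : t ∈ Ico 0 t₁ := ⟨ht.1, ht.2.trans_lt hb⟩
      simp only [dif_pos h, hLH]; simp
    refine hπ.isGeodesicOn_of_comp ?_ ?_ ?_
    · refine ContinuousOn.congr (Continuous.continuousOn ?_) heq
      refine hL.comp (continuous_const.prodMk ?_)
      exact Continuous.subtype_mk (by fun_prop) _
    · intro s hs t ht
      rw [Function.comp, Function.comp, hproj s hs, hproj t ht]
      exact hp.dist_eq s ⟨hs.1, by linarith [hs.2]⟩ t ⟨ht.1, by linarith [ht.2]⟩
    · intro t ht
      rw [hproj t ht]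
      exact hbefore t ⟨ht.1, ht.2.trans_lt hb⟩

end IsSimpleBranchedCover

/-! ### Stewart's inequality in the branched cover -/

section Reverse

variable {X : Type*} [MetricSpace X]

theorem IsGeodesicFromTo.reverse {γ : ℝ → X} {x y : X} (h : IsGeodesicFromTo γ x y) :
    IsGeodesicFromTo (fun t => γ (dist x y - t)) y x := by
  refine ⟨by simp [h.target], by simp [dist_comm y x, h.source], ?_⟩
  rw [dist_comm y x]
  intro s hs t ht
  rw [h.dist_eq _ ⟨by linarith [hs.2], by linarith [hs.1]⟩ _
    ⟨by linarith [ht.2], by linarith [ht.1]⟩, abs_sub_comm]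
  congr 1; ring

/-- Geodesics concatenate to a geodesic if their common endpoint lies between the others. -/
theorem IsGeodesicFromTo.trans {γ δ : ℝ → X} {x y z : X} (hγ : IsGeodesicFromTo γ x y)
    (hδ : IsGeodesicFromTo δ y z) (h : dist x y + dist y z ≤ dist x z) :
    ∃ σ : ℝ → X, IsGeodesicFromTo σ x z := by
  have hd : dist x z = dist x y + dist y z := le_antisymm (dist_triangle _ _ _) h
  have h1 : 0 ≤ dist x y := dist_nonneg
  have h2 : 0 ≤ dist y z := dist_nonneg
  classical
  set σ : ℝ → X := fun t => if t ≤ dist x y then γ t else δ (t - dist x y) with hσ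
  have hr : ∀ t, dist x y ≤ t → σ t = δ (t - dist x y) := by
    intro t ht
    simp only [hσ]
    split_ifs with h'
    · rw [le_antisymm h' ht, hγ.target, sub_self, hδ.source]
    · rfl
  have hl : ∀ t, t ≤ dist x y → σ t = γ t := fun t ht => if_pos ht
  have key : ∀ s t, 0 ≤ s → s ≤ t → t ≤ dist x z → dist (σ s) (σ t) = |s - t| := by
    intro s t hs hst ht
    rcases le_total t (dist x y) with h' | h'
    · rw [hl s (hst.trans h'), hl t h']
      exact hγ.dist_eq s ⟨hs, hst.trans h'⟩ t ⟨hs.trans hst, h'⟩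
    rcases le_total (dist x y) s with h'' | h''
    · rw [hr s h'', hr t h', hδ.dist_eq _ ⟨by linarith, by linarith⟩ _ ⟨by linarith, by linarith⟩]
      congr 1; ring
    · rw [hl s h'', hr t h']
      have m1 : s ∈ Icc 0 (dist x y) := ⟨hs, h''⟩
      have m2 : t - dist x y ∈ Icc 0 (dist y z) := ⟨by linarith, by linarith⟩
      have e1 := hγ.dist_left m1
      have e2 := hγ.dist_right m1
      have e3 := hδ.dist_left m2
      have e4 := hδ.dist_right m2
      have i1 := dist_triangle (γ s) y (δ (t - dist x y))
      have i2 := dist_triangle4 x (γ s) (δ (t - dist x y)) z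
      rw [abs_sub_comm, abs_of_nonneg (sub_nonneg.2 hst)]
      linarith
  refine ⟨σ, by rw [hl 0 h1, hγ.source], ?_, ?_⟩
  · rw [hr _ (by linarith), hd, add_sub_cancel_left, hδ.target]
  · intro s hs t ht
    rcases le_total s t with h' | h'
    · exact key s t hs.1 h' ht.2
    · rw [dist_comm, abs_sub_comm]; exact key t s ht.1 h' hs.2

end Reverse

namespace IsSimpleBranchedCover

variable {X Y : Type*} [MetricSpace X] [MetricSpace Y] {Δ : Set X} {π : Y → X} {κ : ℝ}

/-- A distance in the branched cover is the distance of the images, or the distance of points in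
different copies of the base, glued along the branch locus. -/
theorem dist_eq_gluedDist (hπ : IsSimpleBranchedCover π Δ) (hX : SatisfiesStewart κ X)
    (hgeo : IsGeodesicSpace X) (hsize : ∀ x y : X, LTDivSqrt κ (dist x y) Real.pi) {A P : Y}
    (h : dist (π A) (π P) < dist A P) :
    Δ.Nonempty ∧ dist A P = gluedDist Δ (π A) (π P) := by
  rcases hπ.exists_geodesic_or hX hgeo hsize A P with h' | h'
  · exact absurd h'.1 h.ne'
  · obtain ⟨w, hw, -⟩ := h' 1 one_pos
    refine ⟨⟨w, hw⟩, le_antisymm (le_gluedDist ⟨w, hw⟩ fun v hv => hπ.dist_le_of_mem hv A P) ?_⟩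
    refine le_of_forall_pos_lt_add fun ε hε => ?_
    obtain ⟨v, hv, hlt⟩ := h' ε hε
    exact (gluedDist_le hv _ _).trans_lt hlt

/-- Stewart's inequality for the midpoint of some short segment, if the segment projects to a
geodesic. Where the distance from the apex is that of the base, the distance of the base
supports it from below; elsewhere it is a glued distance. -/
theorem exists_stewart_midpoint (hπ : IsSimpleBranchedCover π Δ) (hX : SatisfiesStewart κ X)
    (hgeo : IsGeodesicSpace X) (hconv : IsGeodesicallyConvex Δ)
    (hsizeX : ∀ x y : X, LTDivSqrt κ (dist x y) (Real.pi / 2))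
    (hsizeY : ∀ x y : Y, LTDivSqrt κ (dist x y) Real.pi) (A : Y) {σ : ℝ → Y} {t h₀ : ℝ}
    (h₀pos : 0 < h₀) (hσ : IsGeodesicOn σ (t - h₀) (t + h₀))
    (hσπ : IsGeodesicOn (π ∘ σ) (t - h₀) (t + h₀)) :
    ∃ h, 0 < h ∧ h ≤ h₀ ∧
      Stewart κ (2 * h) h (dist A (σ (t - h))) (dist A (σ (t + h))) (dist A (σ t)) := by
  have hsize : ∀ x y : X, LTDivSqrt κ (dist x y) Real.pi := fun x y => (hsizeX x y).of_half
  rcases (hπ.dist_map_le A (σ t)).eq_or_lt with heq | hlt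
  · have h1 := hX.stewart_midpoint (π A) h₀pos.le hσπ
    simp only [Function.comp_apply] at h1
    rw [heq] at h1
    refine ⟨h₀, h₀pos, le_rfl, h1.mono ⟨h₀pos.le, by linarith⟩ ?_ dist_nonneg le_rfl
      (hsizeY _ _).le dist_nonneg (hπ.dist_map_le _ _) (hsizeY _ _).le dist_nonneg
      (hπ.dist_map_le _ _) (hsizeY _ _).le⟩
    have := hσ.dist_eq le_rfl (by linarith) le_rfl
    rw [show t + h₀ - (t - h₀) = 2 * h₀ by ring] at this
    rw [← this]
    exact (hsizeY _ _).le
  · have hσc : ContinuousAt σ t :=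
      hσ.continuousOn.continuousAt (Icc_mem_nhds (by linarith) (by linarith))
    have hev : ∀ᶠ s in 𝓝 t, dist (π A) (π (σ s)) < dist A (σ s) := by
      have h1 : ContinuousAt (fun s => dist (π A) (π (σ s))) t :=
        continuousAt_const.dist (hπ.continuous.continuousAt.comp hσc)
      have h2 : ContinuousAt (fun s => dist A (σ s)) t := continuousAt_const.dist hσc
      exact h1.eventually_lt h2 hlt
    obtain ⟨δ, hδ, hball⟩ := Metric.eventually_nhds_iff.1 hev
    have hglue : ∀ s, |s - t| < δ → dist A (σ s) = gluedDist Δ (π A) (π (σ s)) := fun s hs =>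
      (hπ.dist_eq_gluedDist hX hgeo hsize (hball (by rwa [Real.dist_eq]))).2
    have hΔ := (hπ.dist_eq_gluedDist hX hgeo hsize hlt).1
    set h := min h₀ (δ / 2) with hh
    have hpos : 0 < h := lt_min h₀pos (by linarith)
    have hhδ : h < δ := (min_le_right _ _).trans_lt (by linarith)
    have hh₀ : h ≤ h₀ := min_le_left _ _
    have hgeoh : IsGeodesicOn (π ∘ σ) (t - h) (t + h) := hσπ.mono (by linarith) (by linarith)
    have hlen : dist ((π ∘ σ) (t - h)) ((π ∘ σ) (t + h)) = 2 * h := by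
      rw [hgeoh.dist_eq le_rfl (by linarith) le_rfl]; ring
    have := hX.stewart_gluedDist hgeo hsizeX hΔ hconv (π A)
      (hgeoh.isGeodesicFromTo (by linarith)) (t := h) (by rw [hlen]; constructor <;> linarith)
    rw [hlen, sub_add_cancel] at this
    simp only [Function.comp_apply] at this
    rw [← hglue _ (by simpa [abs_of_pos hpos] using hhδ),
      ← hglue _ (by simpa [abs_of_pos hpos] using hhδ), ← hglue t (by simpa using hδ)] at this
    exact ⟨h, hpos, hh₀, this⟩

theorem isGeodesicOn_comp_of_mem (hπ : IsSimpleBranchedCover π Δ) {σ : ℝ → Y} {w y : Y}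
    (hσ : IsGeodesicFromTo σ w y) (hw : π w ∈ Δ) : IsGeodesicOn (π ∘ σ) 0 (dist w y) := by
  have key : ∀ s t, 0 ≤ s → s ≤ t → t ≤ dist w y → dist (π (σ s)) (π (σ t)) = |s - t| := by
    intro s t hs hst ht
    have h1 := hπ.dist_map_le (σ s) (σ t)
    rw [hσ.dist_eq s ⟨hs, hst.trans ht⟩ t ⟨hs.trans hst, ht⟩] at h1
    refine le_antisymm h1 ?_
    have h2 := hσ.dist_left ⟨hs, hst.trans ht⟩
    have h3 := hσ.dist_left ⟨hs.trans hst, ht⟩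
    rw [hπ.dist_eq _ _ (Or.inl hw)] at h2 h3
    have h4 := dist_triangle (π w) (π (σ s)) (π (σ t))
    rw [abs_sub_comm, abs_of_nonneg (sub_nonneg.2 hst)]
    linarith
  intro s hs t ht
  rcases le_total s t with h | h
  · exact key s t hs.1 h ht.2
  · rw [dist_comm, abs_sub_comm]; exact key t s ht.1 h hs.2

/-- Stewart's inequality for a geodesic that starts on the branch locus. -/
theorem stewart_of_mem (hπ : IsSimpleBranchedCover π Δ) (hX : SatisfiesStewart κ X)
    (hgeo : IsGeodesicSpace X) (hconv : IsGeodesicallyConvex Δ)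
    (hsizeX : ∀ x y : X, LTDivSqrt κ (dist x y) (Real.pi / 2))
    (hsizeY : ∀ x y : Y, LTDivSqrt κ (dist x y) Real.pi) (A : Y) {σ : ℝ → Y} {w y : Y}
    (hσ : IsGeodesicFromTo σ w y) (hw : π w ∈ Δ) {s : ℝ} (hs : s ∈ Icc 0 (dist w y)) :
    Stewart κ (dist w y) s (dist A w) (dist A y) (dist A (σ s)) := by
  have h := stewart_of_forall_midpoint (hsizeY w y) (f := fun t => dist A (σ t))
    ((continuous_const.dist continuous_id).comp_continuousOn hσ.isGeodesicOn.continuousOn) ?_ hs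
  · simpa only [hσ.source, hσ.target] using h
  · intro t ht
    have h1 : 0 ≤ t - min t (dist w y - t) := by linarith [min_le_left t (dist w y - t)]
    have h2 : t + min t (dist w y - t) ≤ dist w y := by linarith [min_le_right t (dist w y - t)]
    obtain ⟨h, h0, hle, hst⟩ := hπ.exists_stewart_midpoint hX hgeo hconv hsizeX hsizeY A
      (lt_min ht.1 (by linarith [ht.2])) (hσ.isGeodesicOn.mono h1 h2)
      ((hπ.isGeodesicOn_comp_of_mem hσ hw).mono h1 h2)
    exact ⟨h, h0, hle.trans (min_le_left _ _), hle.trans (min_le_right _ _), hst⟩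

/-- Stewart's inequality at a point of a geodesic on the branch locus. Moving such a point towards
the apex does not shorten the geodesic, although it may be broken in the base. -/
theorem stewart_midpoint_of_mem (hπ : IsSimpleBranchedCover π Δ) (hX : SatisfiesStewart κ X)
    (hgeo : IsGeodesicSpace X) (hΔ : IsClosed Δ) (hconv : IsGeodesicallyConvex Δ)
    (hsizeX : ∀ x y : X, LTDivSqrt κ (dist x y) (Real.pi / 2))
    (hsizeY : ∀ x y : Y, LTDivSqrt κ (dist x y) Real.pi) (A : Y) {γ : ℝ → Y} {t h : ℝ}
    (hh : 0 < h) (hγ : IsGeodesicOn γ (t - h) (t + h)) (hw : π (γ t) ∈ Δ) :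
    Stewart κ (2 * h) h (dist A (γ (t - h))) (dist A (γ (t + h))) (dist A (γ t)) := by
  have d1 : dist (γ (t - h)) (γ t) = h := by
    rw [hγ.dist_eq le_rfl (by linarith) (by linarith)]; ring
  have d2 : dist (γ (t + h)) (γ t) = h := by
    rw [dist_comm, hγ.dist_eq (by linarith) (by linarith) le_rfl]; ring
  have d3 : dist (γ (t - h)) (γ (t + h)) = 2 * h := by
    rw [hγ.dist_eq le_rfl (by linarith) le_rfl]; ring
  have hhκ : LTDivSqrt κ (2 * h) Real.pi := d3 ▸ hsizeY _ _
  rcases (dist_nonneg (x := A) (y := γ t)).eq_or_lt with h0 | h0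
  · rw [stewart_midpoint_iff hh hhκ, ← h0, dist_eq_zero.1 h0.symm, dist_comm (γ t), d1, dist_comm,
      d2, gver_zero]
    linarith
  · obtain ⟨σ', hσ'⟩ := hπ.exists_geodesic_of_mem hgeo hΔ hconv A hw
    have hσ := hσ'.reverse
    refine stewart_of_first_variation h0 (hsizeY _ _) hh hhκ fun τ hτ => ?_
    have hτ' : τ ∈ Icc 0 (dist (γ t) A) := by rw [dist_comm]; exact ⟨hτ.1.le, hτ.2.le⟩
    have s1 := hπ.stewart_of_mem hX hgeo hconv hsizeX hsizeY (γ (t - h)) hσ hw hτ'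
    have s2 := hπ.stewart_of_mem hX hgeo hconv hsizeX hsizeY (γ (t + h)) hσ hw hτ'
    rw [d1, dist_comm (γ t) A, dist_comm _ A] at s1
    rw [d2, dist_comm (γ t) A, dist_comm _ A] at s2
    refine ⟨_, _, dist_nonneg, (hsizeY _ _).le, dist_nonneg, (hsizeY _ _).le, ?_, s1, s2⟩
    rw [← d3]
    exact dist_triangle_right _ _ _

theorem satisfiesStewart (hπ : IsSimpleBranchedCover π Δ) (hX : SatisfiesStewart κ X)
    (hgeo : IsGeodesicSpace X) (hΔ : IsClosed Δ) (hconv : IsGeodesicallyConvex Δ)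
    (hsizeX : ∀ x y : X, LTDivSqrt κ (dist x y) (Real.pi / 2))
    (hsizeY : ∀ x y : Y, LTDivSqrt κ (dist x y) Real.pi) : SatisfiesStewart κ Y := by
  intro A x y γ hγ s hs
  have h := stewart_of_forall_midpoint (hsizeY x y) (f := fun t => dist A (γ t))
    ((continuous_const.dist continuous_id).comp_continuousOn hγ.isGeodesicOn.continuousOn) ?_ hs
  · simpa only [hγ.source, hγ.target] using h
  intro t ht
  set h₁ := min t (dist x y - t) with hh₁
  have h₁pos : 0 < h₁ := lt_min ht.1 (by linarith [ht.2])
  have h₁l : h₁ ≤ t := min_le_left _ _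
  have h₁r : h₁ ≤ dist x y - t := min_le_right _ _
  have hγ₁ : IsGeodesicOn γ (t - h₁) (t + h₁) :=
    hγ.isGeodesicOn.mono (by linarith) (by linarith)
  by_cases hw : π (γ t) ∈ Δ
  · exact ⟨h₁, h₁pos, h₁l, h₁r,
      hπ.stewart_midpoint_of_mem hX hgeo hΔ hconv hsizeX hsizeY A h₁pos hγ₁ hw⟩
  · obtain ⟨U, hU, hiso⟩ := hπ.locally_isometric _ hw
    have hc : ContinuousAt γ t :=
      hγ₁.continuousOn.continuousAt (Icc_mem_nhds (by linarith) (by linarith))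
    obtain ⟨δ, hδ, hball⟩ := Metric.eventually_nhds_iff.1 (hc hU)
    set h₀ := min h₁ (δ / 2) with hh₀
    have h₀pos : 0 < h₀ := lt_min h₁pos (by linarith)
    have h₀₁ : h₀ ≤ h₁ := min_le_left _ _
    have h₀δ : h₀ < δ := (min_le_right _ _).trans_lt (by linarith)
    have hγ₀ : IsGeodesicOn γ (t - h₀) (t + h₀) := hγ₁.mono (by linarith) (by linarith)
    have hin : ∀ s ∈ Icc (t - h₀) (t + h₀), γ s ∈ U := fun s hs => hball (by
      rw [Real.dist_eq, abs_lt]; constructor <;> linarith [hs.1, hs.2])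
    have hγπ : IsGeodesicOn (π ∘ γ) (t - h₀) (t + h₀) := fun a ha b hb =>
      (hiso _ (hin a ha) _ (hin b hb)).trans (hγ₀ a ha b hb)
    obtain ⟨h, h0, hle, hst⟩ := hπ.exists_stewart_midpoint hX hgeo hconv hsizeX hsizeY A
      h₀pos hγ₀ hγπ
    exact ⟨h, h0, by linarith, by linarith, hst⟩

end IsSimpleBranchedCover

/-! ### Complete branch loci -/

section Attained

variable {X : Type*} [MetricSpace X] {κ : ℝ} {Δ : Set X}

/-- The limiting form of Stewart's inequality for a midpoint: the apex is closer to it than to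
the ends. -/
theorem lt_of_stewart_midpoint {h a x : ℝ} (hh : 0 < h) (hhκ : LTDivSqrt κ h (Real.pi / 2))
    (ha : 0 ≤ a) (haκ : LTDivSqrt κ a (Real.pi / 2)) (hxκ : LEDivSqrt κ x Real.pi)
    (hst : 2 * gcos κ h * gver κ x ≤ gver κ a + gver κ a - 2 * gver κ h) : x < a := by
  by_contra! hle
  have h1 := gver_le_gver ha hle hxκ
  have h2 : 0 < gcos κ h := gcos_pos (by rwa [abs_of_pos hh])
  have h3 : 0 < gcos κ a := gcos_pos (by rwa [abs_of_nonneg ha])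
  have h4 := gver_pos hh hhκ.of_half.le
  have h5 := mul_le_mul_of_nonneg_left h1 h2.le
  have h6 := mul_pos h4 h3
  rw [gcos_eq_gver] at h5 h6 hst
  linarith

/-- A glued distance is attained if `Δ` is complete: a minimizing sequence is a Cauchy sequence, as
the midpoints of its terms would otherwise be better. -/
theorem SatisfiesStewart.exists_gluedDist_eq (hX : SatisfiesStewart κ X) {c : ℝ}
    (hc : LTDivSqrt κ c (Real.pi / 2)) (hsize : 0 < κ → ∀ x y : X, dist x y ≤ c)
    (hΔ : Δ.Nonempty) (hconv : IsGeodesicallyConvex Δ) (hcomplete : IsComplete Δ) (A P : X) :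
    ∃ w ∈ Δ, dist A w + dist w P = gluedDist Δ A P := by
  set D := gluedDist Δ A P with hD
  have hsize' : ∀ x y : X, LTDivSqrt κ (dist x y) (Real.pi / 2) := fun x y hκ =>
    (hsize hκ x y).trans_lt (hc hκ)
  obtain ⟨u₀, hu₀, hu₀lim⟩ := exists_seq_tendsto_gluedDist hΔ A P
  obtain ⟨C, hC⟩ := hu₀lim.bddAbove_range
  have hC' : ∀ n, dist A (u₀ n) ∈ Icc 0 C := fun n =>
    ⟨dist_nonneg, le_trans (by linarith [dist_nonneg (x := u₀ n) (y := P)]) (hC ⟨n, rfl⟩)⟩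
  obtain ⟨a, ha, φ, hφ, halim⟩ := isCompact_Icc.tendsto_subseq hC'
  set u : ℕ → X := u₀ ∘ φ with hu
  have hmem : ∀ n, u n ∈ Δ := fun n => hu₀ _
  have hsum : Filter.Tendsto (fun n => dist A (u n) + dist (u n) P) Filter.atTop (𝓝 D) :=
    hu₀lim.comp hφ.tendsto_atTop
  have halim' : Filter.Tendsto (fun n => dist A (u n)) Filter.atTop (𝓝 a) := halim
  have hblim : Filter.Tendsto (fun n => dist (u n) P) Filter.atTop (𝓝 (D - a)) := by
    simpa using hsum.sub halim'
  have hb : 0 ≤ D - a := ge_of_tendsto' hblim fun n => dist_nonneg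
  have haκ : LTDivSqrt κ a (Real.pi / 2) := fun hκ =>
    (le_of_tendsto' halim' fun n => hsize hκ _ _).trans_lt (hc hκ)
  have hbκ : LTDivSqrt κ (D - a) (Real.pi / 2) := fun hκ =>
    (le_of_tendsto' hblim fun n => hsize hκ _ _).trans_lt (hc hκ)
  suffices hcauchy : CauchySeq u by
    obtain ⟨w, hw, hwlim⟩ := cauchySeq_tendsto_of_isComplete hcomplete hmem hcauchy
    refine ⟨w, hw, tendsto_nhds_unique ?_ hsum⟩
    exact (tendsto_const_nhds.dist hwlim).add (hwlim.dist tendsto_const_nhds)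
  by_contra hnot
  rw [Metric.cauchySeq_iff] at hnot
  push Not at hnot
  obtain ⟨ε, hε, hfar⟩ := hnot
  choose m hm n hn hmn using hfar
  have hmlim : Filter.Tendsto m Filter.atTop Filter.atTop :=
    Filter.tendsto_atTop_mono hm Filter.tendsto_id
  have hnlim : Filter.Tendsto n Filter.atTop Filter.atTop :=
    Filter.tendsto_atTop_mono hn Filter.tendsto_id
  have hgeod := fun k => (hconv (u (m k)) (hmem _) (u (n k)) (hmem _))
  choose γ hγ using fun k => (hgeod k).1
  set h : ℕ → ℝ := fun k => dist (u (m k)) (u (n k)) / 2 with hh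
  have hhmem : ∀ k, h k ∈ Icc 0 (dist (u (m k)) (u (n k))) := fun k =>
    ⟨by simp only [hh]; positivity, by
      simp only [hh]; linarith [dist_nonneg (x := u (m k)) (y := u (n k))]⟩
  have hhpos : ∀ k, 0 < h k := fun k => by simp only [hh]; linarith [hmn k]
  have h2h : ∀ k, dist (u (m k)) (u (n k)) = 2 * h k := fun k => by simp only [hh]; ring
  set v : ℕ → X := fun k => γ k (h k) with hv
  have hvΔ : ∀ k, v k ∈ Δ := fun k => (hgeod k).2 _ (hγ k) _ (hhmem k)
  have hst : ∀ B k, 2 * gcos κ (h k) * gver κ (dist B (v k))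
      ≤ gver κ (dist B (u (m k))) + gver κ (dist B (u (n k))) - 2 * gver κ (h k) := by
    intro B k
    have := hX B _ _ _ (hγ k) _ (hhmem k)
    rw [h2h] at this
    exact (stewart_midpoint_iff (hhpos k) (h2h k ▸ (hsize' _ _).of_half)).1 this
  -- a limit of the midpoints' distances
  have hhC : ∀ k, h k ∈ Icc 0 C := fun k => by
    refine ⟨(hhpos k).le, ?_⟩
    have h1 := dist_triangle_left (u (m k)) (u (n k)) A
    have h2 := (hC' (φ (m k))).2
    have h3 := (hC' (φ (n k))).2
    have h4 := h2h k
    simp only [hu, Function.comp_apply] at h1 h4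
    linarith
  have hxC : ∀ k, dist A (v k) ∈ Icc 0 (3 * C) := fun k => by
    refine ⟨dist_nonneg, ?_⟩
    have h1 := dist_triangle A (u (m k)) (v k)
    rw [(hγ k).dist_left (hhmem k)] at h1
    have h2 := (hC' (φ (m k))).2
    have h3 := (hhC k).2
    have h4 := (hhC k).1
    simp only [hu, Function.comp_apply] at h1
    linarith
  obtain ⟨⟨η, x⟩, -, ψ, hψ, hlim⟩ := (isCompact_Icc.prod isCompact_Icc).tendsto_subseq
    (x := fun k => (h k, dist A (v k))) fun k => ⟨hhC k, hxC k⟩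
  have hηlim : Filter.Tendsto (fun k => h (ψ k)) Filter.atTop (𝓝 η) :=
    (continuous_fst.tendsto _).comp hlim
  have hxlim : Filter.Tendsto (fun k => dist A (v (ψ k))) Filter.atTop (𝓝 x) :=
    (continuous_snd.tendsto _).comp hlim
  have hyC : ∀ k, dist P (v (ψ k)) ∈ Icc 0 (dist A P + 3 * C) := fun k => by
    refine ⟨dist_nonneg, ?_⟩
    have h1 := dist_triangle_left P (v (ψ k)) A
    have h2 := (hxC (ψ k)).2
    linarith
  obtain ⟨y, -, θ, hθ, hylim⟩ := isCompact_Icc.tendsto_subseq hyC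
  replace hηlim := hηlim.comp hθ.tendsto_atTop
  replace hxlim := hxlim.comp hθ.tendsto_atTop
  have hηpos : 0 < η := by
    have : ε / 2 ≤ η := ge_of_tendsto' hηlim fun k => by
      simp only [Function.comp_apply, hh]; linarith [hmn (ψ (θ k))]
    linarith
  have hηκ : LTDivSqrt κ η (Real.pi / 2) := fun hκ => by
    refine (le_of_tendsto' hηlim fun k => ?_).trans_lt (hc hκ)
    exact (hhmem _).2.trans (hsize hκ _ _)
  have hcv := continuous_gver κ
  have hcc := continuous_gcos κ
  have hmψ := hmlim.comp (hψ.tendsto_atTop.comp hθ.tendsto_atTop)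
  have hnψ := hnlim.comp (hψ.tendsto_atTop.comp hθ.tendsto_atTop)
  have hlimit : ∀ (B : X) (a' x' : ℝ),
      Filter.Tendsto (fun n => dist B (u n)) Filter.atTop (𝓝 a') →
      Filter.Tendsto (fun k => dist B (v (ψ (θ k)))) Filter.atTop (𝓝 x') →
      2 * gcos κ η * gver κ x' ≤ gver κ a' + gver κ a' - 2 * gver κ η := by
    intro B a' x' ha' hx'
    refine le_of_tendsto_of_tendsto' (b := Filter.atTop) ?_ ?_ fun k => hst B (ψ (θ k))
    · exact (((hcc.tendsto _).comp hηlim).const_mul 2).mul ((hcv.tendsto _).comp hx')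
    · exact (((hcv.tendsto _).comp (ha'.comp hmψ)).add
        ((hcv.tendsto _).comp (ha'.comp hnψ))).sub (((hcv.tendsto _).comp hηlim).const_mul 2)
  have hxκ : LEDivSqrt κ x Real.pi := fun hκ =>
    le_of_tendsto' hxlim fun k => (hsize' _ _).of_half.le hκ
  have hyκ : LEDivSqrt κ y Real.pi := fun hκ =>
    le_of_tendsto' hylim fun k => (hsize' _ _).of_half.le hκ
  have hxa := lt_of_stewart_midpoint hηpos hηκ ha.1 haκ hxκ (hlimit A a x halim' hxlim)
  have hyb := lt_of_stewart_midpoint hηpos hηκ hb hbκ hyκ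
    (hlimit P (D - a) y (by simpa only [dist_comm P] using hblim) hylim)
  have hDxy : D ≤ x + y := ge_of_tendsto' (hxlim.add hylim) fun k => by
    have := gluedDist_le (hvΔ (ψ (θ k))) A P
    simp only [Function.comp_apply]
    rw [dist_comm P]
    exact this
  linarith

end Attained

namespace IsSimpleBranchedCover

variable {X Y : Type*} [MetricSpace X] [MetricSpace Y] {Δ : Set X} {π : Y → X} {κ : ℝ}

theorem isGeodesicSpace (hπ : IsSimpleBranchedCover π Δ) (hX : SatisfiesStewart κ X)
    (hgeo : IsGeodesicSpace X) (hΔ : IsClosed Δ) (hconv : IsGeodesicallyConvex Δ) {c : ℝ}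
    (hc : LTDivSqrt κ c (Real.pi / 2)) (hsize : 0 < κ → ∀ x y : X, dist x y ≤ c)
    (hcomplete : IsComplete Δ) : IsGeodesicSpace Y := by
  intro A P
  have hsize' : ∀ x y : X, LTDivSqrt κ (dist x y) Real.pi := fun x y =>
    LTDivSqrt.of_half fun hκ => (hsize hκ x y).trans_lt (hc hκ)
  rcases hπ.exists_geodesic_or hX hgeo hsize' A P with h | h
  · exact h.2
  · obtain ⟨w₀, hw₀, -⟩ := h 1 one_pos
    obtain ⟨w, hw, hwD⟩ :=
      hX.exists_gluedDist_eq hc hsize ⟨w₀, hw₀⟩ hconv hcomplete (π A) (π P)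
    have hle : dist (π A) w + dist w (π P) ≤ dist A P := by
      rw [hwD]
      refine le_of_forall_pos_lt_add fun ε hε => ?_
      obtain ⟨v, hv, hlt⟩ := h ε hε
      exact (gluedDist_le hv _ _).trans_lt hlt
    obtain ⟨v, rfl⟩ := hπ.exists_mem_fibre hw
    obtain ⟨σ, hσ⟩ := hπ.exists_geodesic_of_mem hgeo hΔ hconv A hw
    obtain ⟨τ, hτ⟩ := hπ.exists_geodesic_of_mem hgeo hΔ hconv P hw
    refine hσ.trans hτ.reverse ?_
    rwa [hπ.dist_eq A v (Or.inr hw), hπ.dist_eq v P (Or.inl hw)]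

end IsSimpleBranchedCover

/-- A strict bound of the diameter of a space bounds the distances uniformly. -/
theorem exists_dist_le_of_ediam_lt {Z : Type*} [MetricSpace Z] {r : ℝ}
    (h : Metric.ediam (univ : Set Z) < ENNReal.ofReal r) :
    (Metric.ediam (univ : Set Z)).toReal < r ∧
      ∀ x y : Z, dist x y ≤ (Metric.ediam (univ : Set Z)).toReal := by
  have hfin : Metric.ediam (univ : Set Z) ≠ ⊤ := h.ne_top
  refine ⟨(ENNReal.lt_ofReal_iff_toReal_lt hfin).1 h, fun x y => ?_⟩
  rw [dist_edist]
  exact ENNReal.toReal_mono hfin (Metric.edist_le_ediam_of_mem (mem_univ x) (mem_univ y))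

theorem theorem3p1 {X Y : Type*} [MetricSpace X] [MetricSpace Y] (κ : ℝ) (Δ : Set X) (π : Y → X)
    (hX : IsCATSpace κ X) (hΔ : IsClosed Δ) (hΔconv : IsGeodesicallyConvex Δ)
    (hπ : IsSimpleBranchedCover π Δ)
    (hdiamX : 0 < κ → Metric.ediam (univ : Set X) < ENNReal.ofReal (Real.pi / (2 * √κ)))
    (hdiamY : 0 < κ → Metric.ediam (univ : Set Y) < ENNReal.ofReal (2 * Real.pi / (3 * √κ))) :
    (∀ T : GeodesicTriangle Y, T.SatisfiesCAT κ) ∧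
      (IsComplete Δ → IsGeodesicSpace Y ∧ IsCATSpace κ Y) := by
  set c := (Metric.ediam (univ : Set X)).toReal with hcdef
  have hc : LTDivSqrt κ c (Real.pi / 2) := fun hκ => by
    have := (exists_dist_le_of_ediam_lt (hdiamX hκ)).1
    rwa [div_div]
  have hcX : 0 < κ → ∀ x y : X, dist x y ≤ c := fun hκ =>
    (exists_dist_le_of_ediam_lt (hdiamX hκ)).2
  have hsizeX : ∀ x y : X, LTDivSqrt κ (dist x y) (Real.pi / 2) := fun x y hκ =>
    (hcX hκ x y).trans_lt (hc hκ)
  have hsizeY : ∀ x y : Y, LTDivSqrt κ (dist x y) (2 * Real.pi / 3) := fun x y hκ => by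
    obtain ⟨h1, h2⟩ := exists_dist_le_of_ediam_lt (hdiamY hκ)
    rw [div_div]
    exact (h2 x y).trans_lt h1
  have hXS : SatisfiesStewart κ X := hX.satisfiesStewart fun x y =>
    (hsizeX x y).mono_right (by linarith [Real.pi_pos])
  have hYS : SatisfiesStewart κ Y := hπ.satisfiesStewart hXS hX.1 hΔ hΔconv hsizeX
    fun x y => (hsizeY x y).of_two_thirds
  have hCAT : ∀ T : GeodesicTriangle Y, T.SatisfiesCAT κ := hYS.satisfiesCAT hsizeY
  refine ⟨hCAT, fun hcomplete => ?_⟩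
  have hgeoY := hπ.isGeodesicSpace hXS hX.1 hΔ hΔconv hc hcX hcomplete
  exact ⟨hgeoY, hgeoY, fun T _ => hCAT T⟩
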